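/- Notation. For $\mu\in\mathbb R$, $\sigma>0$ let $g((\mu,\sigma),\cdot)$ be the Gaussian density with mean $\mu$ and standard deviation $\sigma$. Let $\Theta_o=(\mathbb R\times(0,\infty))^k$, and let $S_k$ be the simplex of probability vectors in $\mathbb R^k$. For $w\in\mathbb R^k$ and $\theta=(\theta_1,\dots,\theta_k)\in\Theta_o$ write $wg(\theta,\cdot)=\sum_{i=1}^k w_i\,g(\theta_i,\cdot)$. Let $\|\cdot\|$ and $\langle\cdot,\cdot\rangle$ be the norm and inner product of $L_2(\mathbb R)$. Setting. Let $f=w^*g(\theta^*,\cdot)$, where $\theta^*\in\Theta_o$ has $k$ distinct components, $w^*_i>0$ for all $i$ and $\sum_i w_i^*=1$. Let $Y_1,Y_2,\dots$ be i.i.d. with density $f$. For each $n\ge 1$ let $\hat f_n$ be a (random) probability density in $L_2(\mathbb R)$. Assume that almost surely $\|\hat f_n-f\|\to0$ and $\sup_{n\ge1}\|\hat f_n\|_\infty<\infty$. For $\theta\in\Theta_o$ let $v^n(\theta)\in\arg\min_{w\in S_k}\|\hat f_n-wg(\theta,\cdot)\|$ and $v(\theta)\in\arg\min_{w\in S_k}\|f-wg(\theta,\cdot)\|$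 (the functions $v^n(\theta)g(\theta,\cdot)$ and $v(\theta)g(\theta,\cdot)$ do not depend on the choice of minimizer), and put $$\ell_n(\theta)=\frac1n\sum_{t=1}^n\ln\big(v^n(\theta)g(\theta,Y_t)\big),\qquad \ell(\theta)=E\ln\big(v(\theta)g(\theta,Y_1)\big).$$ Extension. For $\theta=((\mu_i,\sigma_i))_{i\le k}\in\Theta=([-\infty,\infty]\times[0,\infty])^k$ let $I_0=I_0(\theta)=\{i:\sigma_i\in(0,\infty),|\mu_i|<\infty\}$, $I_1=I_1(\theta)=\{i:\sigma_i\in(0,\infty),|\mu_i|=\infty\}$ and $I_3=I_3(\theta)=\{i:\sigma_i=0\}$. For $I_0\neq\emptyset$ and a matrix $K=(k_{ij})_{i,j\in I_1}$ let $u$ be a minimizer of $$t(w)=\Big\|f-\sum_{i\in I_0}w_i g(\theta_i,\cdot)\Big\|^2+\sum_{i,j\in I_1}w_iw_jk_{ij}$$ over the probability vectors $w$ on $\{1,\dots,k\}\setminus I_3$, and put $\ell(\theta,K)=E\ln\big(\sum_{i\in I_0}u_i g(\theta_i,Y_1)\big)$, with $\ln 0=-\infty$. When $K$ is symmetric and positive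 semidefinite, this does not depend on the choice of $u$. Proposition. The expectation defining $\ell(\theta)$ is finite for every $\theta\in\Theta_o$, and there is an almost sure event, not depending on any of the sequences below, such that the following holds. Let $\theta^n\in\Theta_o$ and $\theta\in\Theta$ satisfy $\theta^n\to\theta$ componentwise and $I_0(\theta)\ne\emptyset$, and let $K_n=(\langle g(\theta^n_i,\cdot),g(\theta^n_j,\cdot)\rangle)_{i,j\in I_1(\theta)}$ converge entrywise to a matrix $K$. Then $\ell(\theta^n)\to\ell(\theta,K)$, and $\ell_n(\theta^n)\to\ell(\theta,K)$ at every outcome in the almost sure event. Corollary. For $0<u<U<\infty$ and $0<N<\infty$ let $\Theta_o(u,U,N)$ be the set of $\theta\in\Theta_o$ with $|\mu_i|\le N$ and $u\le\sigma_i\le U$ for at least one $i$. Then $$P\Big(\sup_{\theta\in\Theta_o(u,U,N)}|\ell_n(\theta)-\ell(\theta)|\to0\Big)=1.$$ -/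

import Mathlib

open MeasureTheory ProbabilityTheory Filter Topology
open scoped ENNReal NNReal

namespace GaussMix

/-- The Gaussian density with mean `p.1` and standard deviation `p.2`. -/
noncomputable def gauss (p : ℝ × ℝ) (y : ℝ) : ℝ :=
  gaussianPDFReal p.1 (Real.toNNReal (p.2 ^ 2)) y

/-- The parameter space `(ℝ × (0,∞))^k`. -/
def ThetaO (k : ℕ) : Set (Fin k → ℝ × ℝ) := {θ | ∀ i, 0 < (θ i).2}

/-- The parameters that have a component with mean in `[-N,N]` and standard deviation in `[u,U]`. -/
def ThetaBox (k : ℕ) (u U N : ℝ) : Set (Fin k → ℝ × ℝ) :=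
  {θ | θ ∈ ThetaO k ∧ ∃ i, (θ i).1 ∈ Set.Icc (-N) N ∧ (θ i).2 ∈ Set.Icc u U}

/-- The mixture `w g(θ, ·) = ∑ i, w_i g(θ_i, ·)`. -/
noncomputable def mix {k : ℕ} (w : Fin k → ℝ) (θ : Fin k → ℝ × ℝ) (y : ℝ) : ℝ :=
  ∑ i, w i * gauss (θ i) y

/-- The norm of `L²(ℝ)` with Lebesgue measure. -/
noncomputable def l2norm (h : ℝ → ℝ) : ℝ := (eLpNorm h 2 volume).toReal

/-- The probability law on `ℝ` with Lebesgue density `f`. -/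
noncomputable def law (f : ℝ → ℝ) : Measure ℝ :=
  volume.withDensity (fun y => ENNReal.ofReal (f y))

/-- `w` is a point of the simplex that minimizes the `L²` distance from `φ` to `w g(θ, ·)`. -/
def IsWeights {k : ℕ} (φ : ℝ → ℝ) (θ : Fin k → ℝ × ℝ) (w : Fin k → ℝ) : Prop :=
  w ∈ stdSimplex ℝ (Fin k) ∧
    IsMinOn (fun w' : Fin k → ℝ => l2norm (fun y => φ y - mix w' θ y)) (stdSimplex ℝ (Fin k)) w

/-- A choice of minimizing weights. Minimizers exist for `φ` in `L²` (proved below); they need not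
be unique, but the fitted mixture `fit φ θ` does not depend on the choice. -/
noncomputable def weights {k : ℕ} (φ : ℝ → ℝ) (θ : Fin k → ℝ × ℝ) : Fin k → ℝ :=
  Classical.epsilon (IsWeights φ θ)

/-- The best `L²` approximation of `φ` by mixtures of the `k` given Gaussian components. -/
noncomputable def fit {k : ℕ} (φ : ℝ → ℝ) (θ : Fin k → ℝ × ℝ) : ℝ → ℝ := mix (weights φ θ) θ

/-- The log-pseudo-likelihood of the sample `y 0, …, y (n-1)` when the weights are fitted to `φ`. -/
noncomputable def logPL {k : ℕ} (n : ℕ) (y : ℕ → ℝ) (φ : ℝ → ℝ) (θ : Fin k → ℝ × ℝ) : ℝ :=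
  (1 / (n : ℝ)) * ∑ t ∈ Finset.range n, Real.log (fit φ θ (y t))

/-- The limit criterion `ℓ(θ) = E ln (v(θ) g(θ, Y))`, where `Y` has density `f`. -/
noncomputable def ell {k : ℕ} (f : ℝ → ℝ) (θ : Fin k → ℝ × ℝ) : ℝ :=
  ∫ y, Real.log (fit f θ y) ∂(law f)

/-- The inclusion of the parameter space in its compactification `([-∞,∞] × [0,∞])^k`. -/
noncomputable def emb {k : ℕ} (θ : Fin k → ℝ × ℝ) : Fin k → EReal × ℝ≥0∞ :=
  fun i => (((θ i).1 : EReal), ENNReal.ofReal (θ i).2)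

/-- Components with `σ_i ∈ (0,∞)` and finite mean. -/
noncomputable def I0 {k : ℕ} (θ : Fin k → EReal × ℝ≥0∞) : Finset (Fin k) :=
  Finset.univ.filter fun i =>
    ((θ i).2 ≠ 0 ∧ (θ i).2 ≠ ⊤) ∧ ((θ i).1 ≠ ⊥ ∧ (θ i).1 ≠ ⊤)

/-- Components with `σ_i ∈ (0,∞)` and infinite mean. -/
noncomputable def I1 {k : ℕ} (θ : Fin k → EReal × ℝ≥0∞) : Finset (Fin k) :=
  Finset.univ.filter fun i =>
    ((θ i).2 ≠ 0 ∧ (θ i).2 ≠ ⊤) ∧ ((θ i).1 = ⊥ ∨ (θ i).1 = ⊤)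

/-- Components with `σ_i = 0`. The remaining ones, outside `I0`, `I1` and `I3`, have `σ_i = ∞`. -/
noncomputable def I3 {k : ℕ} (θ : Fin k → EReal × ℝ≥0∞) : Finset (Fin k) :=
  Finset.univ.filter fun i => (θ i).2 = 0

/-- The Gram matrix entry `⟨g_i, g_j⟩` in `L²(ℝ)`. -/
noncomputable def gram {k : ℕ} (θ : Fin k → ℝ × ℝ) (i j : Fin k) : ℝ :=
  ∫ y, gauss (θ i) y * gauss (θ j) y

/-- The simplex of weights on the components with `σ_i > 0`, as weight vectors on all components
that vanish where `σ_i = 0`. -/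
def extSimplex {k : ℕ} (θ : Fin k → EReal × ℝ≥0∞) : Set (Fin k → ℝ) :=
  {w | w ∈ stdSimplex ℝ (Fin k) ∧ ∀ i ∈ I3 θ, w i = 0}

/-- The restricted mixture `w_{I0} g`. -/
noncomputable def mix0 {k : ℕ} (w : Fin k → ℝ) (θ : Fin k → EReal × ℝ≥0∞) (y : ℝ) : ℝ :=
  ∑ i ∈ I0 θ, w i * gauss ((θ i).1.toReal, (θ i).2.toReal) y

/-- The limit objective `t(w) = ‖f - w_{I0} g‖² + ∑_{i,j ∈ I1} w_i w_j k_{ij}`. -/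
noncomputable def tObj {k : ℕ} (f : ℝ → ℝ) (θ : Fin k → EReal × ℝ≥0∞)
    (K : Matrix (I1 θ) (I1 θ) ℝ) (w : Fin k → ℝ) : ℝ :=
  l2norm (fun y => f y - mix0 w θ y) ^ 2 + ∑ i : I1 θ, ∑ j : I1 θ, w i * w j * K i j

/-- `w` minimizes the limit objective over `extSimplex θ`. -/
def IsExtWeights {k : ℕ} (f : ℝ → ℝ) (θ : Fin k → EReal × ℝ≥0∞)
    (K : Matrix (I1 θ) (I1 θ) ℝ) (w : Fin k → ℝ) : Prop :=
  w ∈ extSimplex θ ∧ IsMinOn (tObj f θ K) (extSimplex θ) w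

/-- A choice of minimizer of the limit objective. It exists when `f` is in `L²` and `I0 θ` is
nonempty (proved below), and for `K` symmetric and positive semidefinite the function
`mix0 (extWeights f θ K) θ` does not depend on the choice. -/
noncomputable def extWeights {k : ℕ} (f : ℝ → ℝ) (θ : Fin k → EReal × ℝ≥0∞)
    (K : Matrix (I1 θ) (I1 θ) ℝ) : Fin k → ℝ :=
  Classical.epsilon (IsExtWeights f θ K)

/-- The expectation `∫ ln φ dP ∈ [-∞,∞]` of the logarithm (with `ln 0 = -∞`) of `φ ≥ 0`, as
integral of the positive part minus integral of the negative part. -/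
noncomputable def expLog (P : Measure ℝ) (φ : ℝ → ℝ) : EReal :=
  ((∫⁻ y, (ENNReal.log (ENNReal.ofReal (φ y))).toENNReal ∂P : ℝ≥0∞) : EReal) -
    ((∫⁻ y, (-ENNReal.log (ENNReal.ofReal (φ y))).toENNReal ∂P : ℝ≥0∞) : EReal)

/-- The extended criterion `ℓ(θ,K) = E ln (u_{I0} g(θ, Y))`, where `Y` has density `f`. -/
noncomputable def ellExt {k : ℕ} (f : ℝ → ℝ) (θ : Fin k → EReal × ℝ≥0∞)
    (K : Matrix (I1 θ) (I1 θ) ℝ) : EReal :=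
  expLog (law f) (mix0 (extWeights f θ K) θ)

theorem memLp_gauss (p : ℝ × ℝ) : MemLp (gauss p) 2 volume := by
  have hm : AEStronglyMeasurable (gauss p) volume :=
    (measurable_gaussianPDFReal _ _).aestronglyMeasurable
  rw [memLp_two_iff_integrable_sq hm]
  have hi : Integrable (gauss p) volume := integrable_gaussianPDFReal _ _
  have hb : ∀ y, ‖gauss p y‖ ≤ (√(2 * Real.pi * Real.toNNReal (p.2 ^ 2)))⁻¹ := by
    intro y
    have h0 : 0 ≤ gauss p y := gaussianPDFReal_nonneg _ _ _
    rw [Real.norm_of_nonneg h0]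
    unfold gauss gaussianPDFReal
    refine mul_le_of_le_one_right (by positivity) (Real.exp_le_one_iff.2 ?_)
    exact div_nonpos_of_nonpos_of_nonneg (by nlinarith [sq_nonneg (y - p.1)]) (by positivity)
  simpa [sq] using hi.bdd_mul hm (Eventually.of_forall hb)

/-- The `L²` distance from `φ` to a finite combination of `L²` functions is continuous in the
coefficients. -/
theorem continuous_l2norm_sub {ι : Type*} (s : Finset ι) (φ : ℝ → ℝ) (G : ι → ℝ → ℝ)
    (hφ : MemLp φ 2 volume) (hG : ∀ i ∈ s, MemLp (G i) 2 volume) :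
    Continuous fun w : ι → ℝ => l2norm (fun y => φ y - ∑ i ∈ s, w i * G i y) := by
  classical
  let F : ι → Lp ℝ 2 (volume : Measure ℝ) := fun i =>
    if h : MemLp (G i) 2 volume then h.toLp (G i) else 0
  have key : (fun w : ι → ℝ => l2norm (fun y => φ y - ∑ i ∈ s, w i * G i y)) =
      fun w => ‖hφ.toLp φ - ∑ i ∈ s, w i • F i‖ := by
    funext w
    rw [Lp.norm_def]
    unfold l2norm
    congr 1
    refine eLpNorm_congr_ae ?_
    have h1 : ∀ i ∈ s, (⇑(w i • F i) : ℝ → ℝ) =ᵐ[volume] fun y => w i * G i y := by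
      intro i hi
      have : F i = (hG i hi).toLp (G i) := dif_pos (hG i hi)
      rw [this]
      filter_upwards [Lp.coeFn_smul (w i) ((hG i hi).toLp (G i)), (hG i hi).coeFn_toLp] with y h h'
      rw [h, Pi.smul_apply, h', smul_eq_mul]
    have h2 : (⇑(∑ i ∈ s, w i • F i) : ℝ → ℝ) =ᵐ[volume] fun y => ∑ i ∈ s, w i * G i y := by
      have h3 : ∀ᵐ y ∂(volume : Measure ℝ), ∀ i ∈ s, (w i • F i : Lp ℝ 2 volume) y = w i * G i y :=
        (ae_ball_iff s.countable_toSet).2 h1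
      filter_upwards [Lp.coeFn_finsetSum s (fun i => w i • F i), h3] with y h h'
      rw [h, Finset.sum_apply]
      exact Finset.sum_congr rfl h'
    filter_upwards [Lp.coeFn_sub (hφ.toLp φ) (∑ i ∈ s, w i • F i), h2, hφ.coeFn_toLp] with y a b c
    rw [a, Pi.sub_apply, b, c]
  rw [key]
  fun_prop

/-- Minimizing weights exist. -/
theorem isWeights_weights {k : ℕ} (hk : 0 < k) {φ : ℝ → ℝ} (hφ : MemLp φ 2 volume)
    (θ : Fin k → ℝ × ℝ) : IsWeights φ θ (weights φ θ) := by
  refine Classical.epsilon_spec (p := IsWeights φ θ) ?_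
  have hc := continuous_l2norm_sub Finset.univ φ (fun i => gauss (θ i)) hφ
    (fun i _ => memLp_gauss (θ i))
  obtain ⟨w, hw, hmin⟩ := (isCompact_stdSimplex ℝ (Fin k)).exists_isMinOn
    ⟨_, single_mem_stdSimplex ℝ (⟨0, hk⟩ : Fin k)⟩ hc.continuousOn
  exact ⟨w, hw, hmin⟩

/-- A minimizer of the limit objective exists. -/
theorem isExtWeights_extWeights {k : ℕ} {f : ℝ → ℝ} (hf : MemLp f 2 volume)
    {θ : Fin k → EReal × ℝ≥0∞} (hθ : (I0 θ).Nonempty) (K : Matrix (I1 θ) (I1 θ) ℝ) :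
    IsExtWeights f θ K (extWeights f θ K) := by
  refine Classical.epsilon_spec (p := IsExtWeights f θ K) ?_
  have hc : Continuous (tObj f θ K) := by
    have hc0 := continuous_l2norm_sub (I0 θ) f
      (fun i => gauss ((θ i).1.toReal, (θ i).2.toReal)) hf (fun i _ => memLp_gauss _)
    unfold tObj
    refine (hc0.pow 2).add ?_
    fun_prop
  have hcl : IsClosed {w : Fin k → ℝ | ∀ i ∈ I3 θ, w i = 0} := by
    simp only [Set.ofPred_forall]
    exact isClosed_iInter fun i => isClosed_iInter fun _ =>
      isClosed_eq (continuous_apply i) continuous_const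
  have hcomp : IsCompact (extSimplex θ) := (isCompact_stdSimplex ℝ (Fin k)).inter_right hcl
  obtain ⟨j, hj⟩ := hθ
  have hne : (extSimplex θ).Nonempty := by
    refine ⟨_, single_mem_stdSimplex ℝ j, fun i hi => ?_⟩
    have h0 := (Finset.mem_filter.1 hj).2.1.1
    have h1 := (Finset.mem_filter.1 hi).2
    exact Pi.single_eq_of_ne (fun h => h0 (by rw [← h]; exact h1)) _
  obtain ⟨w, hw, hmin⟩ := hcomp.exists_isMinOn hne hc.continuousOn
  exact ⟨w, hw, hmin⟩

end GaussMix

/-!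
The core is deterministic: `Approach.tendsto_integral` shows that `∫ ln (fit φₙ θₙ) dμₙ` converges to
`ℓ(θ, K)` whenever `θₙ → θ` in the compactification with converging Gram matrices, `φₙ → f` in `L²`
with `φₙ` uniformly bounded, and the measures `μₙ` converge to the true law on continuous functions
of quadratic growth (`QuadConv`). Empirical measures have this property almost surely
(`ae_quadConv_empirical`), which gives the limit of `ℓₙ` with an exceptional set that does not
depend on the parameters; constant `μₙ` and `φₙ = f` give the limit of `ℓ`.

Why the core holds. Pass to a subsequence along which the fitted weights `vₙ` converge to some `u`.

* Comparing a component `i` with one that converges, the optimality condition of the quadratic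
  programme bounds `vₙᵢ ‖gᵢ‖²`, since `⟨φₙ, gᵢ⟩ ≤ sup φₙ`. As `‖gᵢ‖²` is of the order `1 / σᵢ`, this
  gives `vₙᵢ ≤ C σᵢ` (`Approach.exists_weights_le`). So the fitted mixtures are uniformly bounded, and
  components whose scale vanishes disappear in `L²` and pointwise off the limit of their mean.
* Components with `σᵢ → ∞` vanish in `L²`. Those with bounded scale and escaping mean tend weakly to
  zero, so that only their Gram form survives in the objective (`tendsto_norm_sub_sum_sq`). Hence
  `u` minimizes the limit objective, whose fitted function is unique by strict convexity. It is not
  zero, since some mass on a Gaussian density that is not orthogonal to `f` pays off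
  (`exists_ne_zero_of_isMinOn`).
* Therefore the logarithms of the fitted mixtures are eventually bounded by `C (1 + y²)`, and
  converge continuously off the finitely many limits of the means. Off small neighbourhoods of these
  points and of infinity the convergence is uniform, and these neighbourhoods have small mass
  (`QuadConv.tendsto_integral`).

Uniform convergence over a box follows by compactness: a sequence of parameters in the box has a
subsequence of the kind above, along which `ℓₙ` and `ℓ` have the same finite limit.
-/

namespace GaussMix

/-! ### Weak convergence with second moments -/

/-- Convergence of integrals against all continuous functions of at most quadratic growth, that is,
weak convergence together with convergence of second moments. -/
structure QuadConv (μs : ℕ → Measure ℝ) (μ : Measure ℝ) : Prop where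
  integrable_seq : ∀ n, Integrable (fun y : ℝ => 1 + y ^ 2) (μs n)
  integrable_lim : Integrable (fun y : ℝ => 1 + y ^ 2) μ
  tendsto : ∀ (ψ : ℝ → ℝ) (C : ℝ), Continuous ψ → (∀ y, |ψ y| ≤ C * (1 + y ^ 2)) →
    Tendsto (fun n => ∫ y, ψ y ∂(μs n)) atTop (𝓝 (∫ y, ψ y ∂μ))

theorem integrable_of_abs_le_quad {μ : Measure ℝ} (h : Integrable (fun y : ℝ => 1 + y ^ 2) μ)
    {ψ : ℝ → ℝ} {C : ℝ} (hψ : AEStronglyMeasurable ψ μ) (hb : ∀ y, |ψ y| ≤ C * (1 + y ^ 2)) :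
    Integrable ψ μ :=
  (h.const_mul C).mono' hψ (Eventually.of_forall fun y => by simpa using hb y)

theorem QuadConv.comp {μs : ℕ → Measure ℝ} {μ : Measure ℝ} (h : QuadConv μs μ) {s : ℕ → ℕ}
    (hs : Tendsto s atTop atTop) : QuadConv (fun n => μs (s n)) μ :=
  ⟨fun _ => h.integrable_seq _, h.integrable_lim, fun ψ C hψ hb => (h.tendsto ψ C hψ hb).comp hs⟩

theorem QuadConv.const {μ : Measure ℝ} (h : Integrable (fun y : ℝ => 1 + y ^ 2) μ) :
    QuadConv (fun _ => μ) μ :=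
  ⟨fun _ => h, h, fun _ _ _ _ => tendsto_const_nhds⟩

/-- Integrals of nonnegative continuous functions are lower semicontinuous. -/
theorem eventually_lt_integral {μs : ℕ → Measure ℝ} {μ : Measure ℝ}
    (hopen : ∀ G : Set ℝ, IsOpen G → μ G ≤ atTop.liminf fun n => μs n G)
    {φ : ℝ → ℝ} (hφ : Continuous φ) (h0 : ∀ y, 0 ≤ φ y) (hi : Integrable φ μ)
    (his : ∀ n, Integrable φ (μs n)) {c : ℝ} (hc : c < ∫ y, φ y ∂μ) :
    ∀ᶠ n in atTop, c < ∫ y, φ y ∂(μs n) := by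
  rcases lt_or_ge c 0 with hneg | hpos
  · exact Eventually.of_forall fun n => hneg.trans_le (integral_nonneg h0)
  have key := lintegral_le_liminf_lintegral_of_forall_isOpen_measure_le_liminf_measure hφ h0 hopen
  rw [← ofReal_integral_eq_lintegral_ofReal hi (Eventually.of_forall h0)] at key
  have hlt : ENNReal.ofReal c < atTop.liminf fun n => ∫⁻ y, ENNReal.ofReal (φ y) ∂(μs n) :=
    lt_of_lt_of_le ((ENNReal.ofReal_lt_ofReal_iff (hpos.trans_lt hc)).2 hc) key
  filter_upwards [eventually_lt_of_lt_liminf hlt] with n hn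
  rw [← ofReal_integral_eq_lintegral_ofReal (his n) (Eventually.of_forall h0)] at hn
  exact (ENNReal.ofReal_lt_ofReal_iff_of_nonneg hpos).1 hn

/-- Portmanteau: the open-set criterion and convergence of second moments. -/
theorem quadConv_of_isOpen {μs : ℕ → Measure ℝ} {μ : Measure ℝ}
    (hs : ∀ n, Integrable (fun y : ℝ => 1 + y ^ 2) (μs n))
    (h : Integrable (fun y : ℝ => 1 + y ^ 2) μ)
    (hopen : ∀ G : Set ℝ, IsOpen G → μ G ≤ atTop.liminf fun n => μs n G)
    (hmom : Tendsto (fun n => ∫ y, (1 + y ^ 2) ∂(μs n)) atTop (𝓝 (∫ y, (1 + y ^ 2) ∂μ))) :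
    QuadConv μs μ := by
  refine ⟨hs, h, ?_⟩
  -- the lower bound, from lower semicontinuity applied to `C (1 + y²) + ψ ≥ 0`
  have low : ∀ (ψ : ℝ → ℝ) (C : ℝ), Continuous ψ → (∀ y, |ψ y| ≤ C * (1 + y ^ 2)) →
      ∀ c < ∫ y, ψ y ∂μ, ∀ᶠ n in atTop, c < ∫ y, ψ y ∂(μs n) := by
    intro ψ C hψ hb c hc
    have iψ : Integrable ψ μ := integrable_of_abs_le_quad h hψ.aestronglyMeasurable hb
    have iψs : ∀ n, Integrable ψ (μs n) := fun n =>
      integrable_of_abs_le_quad (hs n) hψ.aestronglyMeasurable hb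
    have e : ∀ ν : Measure ℝ, Integrable (fun y : ℝ => 1 + y ^ 2) ν → Integrable ψ ν →
        ∫ y, (C * (1 + y ^ 2) + ψ y) ∂ν = C * ∫ y, (1 + y ^ 2) ∂ν + ∫ y, ψ y ∂ν := by
      intro ν h1 h2
      rw [integral_add (h1.const_mul C) h2, integral_const_mul]
    have h1 := eventually_lt_integral hopen (φ := fun y => C * (1 + y ^ 2) + ψ y)
      (by fun_prop) (fun y => by linarith [neg_abs_le (ψ y), hb y]) ((h.const_mul C).add iψ)
      (fun n => ((hs n).const_mul C).add (iψs n))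
      (c := C * ∫ y, (1 + y ^ 2) ∂μ + (c + ∫ y, ψ y ∂μ) / 2)
      (by rw [e μ h iψ]; linarith)
    have h2 := (hmom.const_mul C).eventually_lt_const
      (show C * ∫ y, (1 + y ^ 2) ∂μ < C * ∫ y, (1 + y ^ 2) ∂μ + ((∫ y, ψ y ∂μ) - c) / 2 by linarith)
    filter_upwards [h1, h2] with n a b
    rw [e _ (hs n) (iψs n)] at a
    linarith
  intro ψ C hψ hb
  refine tendsto_order.2 ⟨low ψ C hψ hb, fun c hc => ?_⟩
  have := low (fun y => -ψ y) C hψ.neg (by simpa using hb) (-c) (by rw [integral_neg]; linarith)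
  filter_upwards [this] with n hn
  rw [integral_neg] at hn
  linarith

/-- The trapezoidal cutoff: `0` below `0`, `1` above `1`. -/
noncomputable def clamp (x : ℝ) : ℝ := max 0 (min 1 x)

theorem continuous_clamp : Continuous clamp := by unfold clamp; fun_prop

theorem clamp_nonneg (x : ℝ) : 0 ≤ clamp x := le_max_left _ _

theorem clamp_le_one (x : ℝ) : clamp x ≤ 1 := max_le zero_le_one (min_le_left _ _)

theorem clamp_eq_one {x : ℝ} (h : 1 ≤ x) : clamp x = 1 := by simp [clamp, h]

theorem clamp_eq_zero {x : ℝ} (h : x ≤ 0) : clamp x = 0 := by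
  simp only [clamp, max_eq_left_iff]; exact (min_le_right _ _).trans h

/-- A continuous function that dominates the indicator of the complement of
`{y | |y| ≤ j ∧ ∀ i, 1 ≤ j * |y - a i|}`. -/
noncomputable def cutoff {k : ℕ} (a : Fin k → ℝ) (j : ℕ) (y : ℝ) : ℝ :=
  clamp (|y| - j + 1) + ∑ i, clamp (2 - j * |y - a i|)

theorem continuous_cutoff {k : ℕ} (a : Fin k → ℝ) (j : ℕ) : Continuous (cutoff a j) := by
  unfold cutoff
  refine (continuous_clamp.comp (by fun_prop)).add (continuous_finsetSum _ fun i _ =>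
    continuous_clamp.comp (by fun_prop))

theorem cutoff_nonneg {k : ℕ} (a : Fin k → ℝ) (j : ℕ) (y : ℝ) : 0 ≤ cutoff a j y :=
  add_nonneg (clamp_nonneg _) (Finset.sum_nonneg fun _ _ => clamp_nonneg _)

theorem cutoff_le {k : ℕ} (a : Fin k → ℝ) (j : ℕ) (y : ℝ) : cutoff a j y ≤ 1 + k := by
  refine add_le_add (clamp_le_one _) ?_
  simpa using Finset.sum_le_sum (s := Finset.univ)
    fun (i : Fin k) _ => clamp_le_one (2 - j * |y - a i|)

theorem one_le_cutoff {k : ℕ} (a : Fin k → ℝ) (j : ℕ) (y : ℝ)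
    (h : ¬ (|y| ≤ j ∧ ∀ i, 1 ≤ j * |y - a i|)) : 1 ≤ cutoff a j y := by
  by_cases h1 : |y| ≤ j
  · have h2 : ∃ i, j * |y - a i| < 1 := by
      by_contra! hc
      exact h ⟨h1, hc⟩
    obtain ⟨i, hi⟩ := h2
    have := Finset.single_le_sum (f := fun i => clamp (2 - j * |y - a i|))
      (fun i _ => clamp_nonneg _) (Finset.mem_univ i)
    simp only [clamp_eq_one (show (1 : ℝ) ≤ 2 - j * |y - a i| by linarith)] at this
    unfold cutoff
    linarith [clamp_nonneg (|y| - j + 1)]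
  · unfold cutoff
    rw [clamp_eq_one (by linarith)]
    linarith [Finset.sum_nonneg (s := Finset.univ)
      fun (i : Fin k) _ => clamp_nonneg (2 - j * |y - a i|)]

theorem tendsto_cutoff {k : ℕ} (a : Fin k → ℝ) {y : ℝ} (hy : ∀ i, y ≠ a i) :
    Tendsto (fun j => cutoff a j y) atTop (𝓝 0) := by
  have h1 : ∀ᶠ j : ℕ in atTop, |y| - j + 1 ≤ 0 := by
    filter_upwards [tendsto_natCast_atTop_atTop.eventually_ge_atTop (|y| + 1)] with j hj
    linarith
  have h2 : ∀ᶠ j : ℕ in atTop, ∀ i, 2 - j * |y - a i| ≤ 0 := by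
    refine eventually_all.2 fun i => ?_
    have hp : 0 < |y - a i| := abs_pos.2 (sub_ne_zero.2 (hy i))
    filter_upwards [tendsto_natCast_atTop_atTop.eventually_ge_atTop (2 / |y - a i|)] with j hj
    rw [div_le_iff₀ hp] at hj
    linarith
  refine tendsto_const_nhds.congr' ?_
  filter_upwards [h1, h2] with j a1 a2
  simp [cutoff, clamp_eq_zero a1, clamp_eq_zero (a2 _)]

/-- Integrals of functions of quadratic growth that converge continuously off a finite null set
converge along with the measures. -/
theorem QuadConv.tendsto_integral {μs : ℕ → Measure ℝ} {μ : Measure ℝ} (hμ : QuadConv μs μ)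
    {k : ℕ} (a : Fin k → ℝ) (ha : ∀ i, μ {a i} = 0) {h : ℕ → ℝ → ℝ} {g : ℝ → ℝ} {C : ℝ}
    (hmeas : ∀ n, Measurable (h n)) (hg : Continuous g)
    (hb : ∀ᶠ n in atTop, ∀ y, |h n y| ≤ C * (1 + y ^ 2)) (hgb : ∀ y, |g y| ≤ C * (1 + y ^ 2))
    (hconv : ∀ y, (∀ i, y ≠ a i) →
      Tendsto (fun p : ℕ × ℝ => h p.1 p.2) (atTop ×ˢ 𝓝 y) (𝓝 (g y))) :
    Tendsto (fun n => ∫ y, h n y ∂(μs n)) atTop (𝓝 (∫ y, g y ∂μ)) := by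
  have hC : 0 ≤ C := by
    have := hgb 0
    simp only [ne_eq, OfNat.ofNat_ne_zero, not_false_eq_true, zero_pow, add_zero, mul_one] at this
    exact (abs_nonneg _).trans this
  -- the cutoffs carry little mass
  have hcut : Tendsto (fun j => ∫ y, (1 + y ^ 2) * cutoff a j y ∂μ) atTop (𝓝 0) := by
    have : Tendsto (fun j => ∫ y, (1 + y ^ 2) * cutoff a j y ∂μ) atTop (𝓝 (∫ _, (0 : ℝ) ∂μ)) := by
      refine tendsto_integral_of_dominated_convergence (fun y => (1 + k) * (1 + y ^ 2))
        (fun j => ?_) (hμ.integrable_lim.const_mul _) (fun j => Eventually.of_forall fun y => ?_) ?_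
      · have := continuous_cutoff a j
        exact Continuous.aestronglyMeasurable (by fun_prop)
      · rw [Real.norm_of_nonneg (mul_nonneg (by positivity) (cutoff_nonneg a j y)), mul_comm]
        exact mul_le_mul_of_nonneg_right (cutoff_le a j y) (by positivity)
      · have : ∀ᵐ y ∂μ, ∀ i, y ≠ a i := ae_all_iff.2 fun i => by
          rw [ae_iff]; simpa using ha i
        filter_upwards [this] with y hy
        simpa using (tendsto_cutoff a hy).const_mul (1 + y ^ 2)
    simpa using this
  have hgs := hμ.tendsto g C hg hgb
  suffices hd : Tendsto (fun n => ∫ y, h n y ∂(μs n) - ∫ y, g y ∂(μs n)) atTop (𝓝 0) by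
    simpa using hd.add hgs
  rw [Metric.tendsto_atTop']
  intro ε hε
  set M : ℝ := (∫ y, (1 + y ^ 2) ∂μ) + 1 with hM
  have hMpos : 0 < M := by
    have : 0 ≤ ∫ y, (1 + y ^ 2) ∂μ := integral_nonneg fun y => by positivity
    linarith
  -- choose the cutoff level
  obtain ⟨j, hj⟩ := ((hcut.const_mul (2 * C)).eventually_lt_const
    (show 2 * C * 0 < ε / 2 by simpa using half_pos hε)).exists
  set E : Set ℝ := {y | |y| ≤ j ∧ ∀ i, 1 ≤ j * |y - a i|} with hE
  have hEc : IsCompact E := by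
    refine Metric.isCompact_of_isClosed_isBounded ?_ ?_
    · have h1 : IsClosed {y : ℝ | |y| ≤ j} := isClosed_le (by fun_prop) (by fun_prop)
      have h2 : IsClosed {y : ℝ | ∀ i, 1 ≤ j * |y - a i|} := by
        have : {y : ℝ | ∀ i, 1 ≤ j * |y - a i|} = ⋂ i, {y : ℝ | 1 ≤ j * |y - a i|} := by
          ext; simp
        rw [this]
        exact isClosed_iInter fun i => isClosed_le (by fun_prop) (by fun_prop)
      exact h1.inter h2
    · exact (Metric.isBounded_closedBall (x := (0 : ℝ)) (r := j)).subset fun y hy => by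
        simpa using hy.1
  have hunif : TendstoUniformlyOn h g atTop E := by
    rw [← tendstoLocallyUniformlyOn_iff_tendstoUniformlyOn_of_compact hEc,
      tendstoLocallyUniformlyOn_iff_filter]
    intro y hy
    have hne : ∀ i, y ≠ a i := fun i hi => by
      have := hy.2 i
      rw [hi] at this
      norm_num at this
    rw [tendstoUniformlyOnFilter_iff_tendsto]
    have h1 : Tendsto (fun p : ℕ × ℝ => h p.1 p.2) (atTop ×ˢ 𝓝[E] y) (𝓝 (g y)) :=
      (hconv y hne).mono_left (Filter.prod_mono le_rfl nhdsWithin_le_nhds)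
    have h2 : Tendsto (fun p : ℕ × ℝ => g p.2) (atTop ×ˢ 𝓝[E] y) (𝓝 (g y)) :=
      ((hg.tendsto y).mono_left nhdsWithin_le_nhds).comp tendsto_snd
    exact tendsto_uniformity_iff_dist_tendsto_zero.2 (by simpa using h2.dist h1)
  have hδ : 0 < ε / (2 * M) / 2 := by positivity
  have hcn := hμ.tendsto (fun y => (1 + y ^ 2) * cutoff a j y) (1 + k)
    (by have := continuous_cutoff a j; fun_prop) (fun y => by
      rw [abs_of_nonneg (mul_nonneg (by positivity) (cutoff_nonneg a j y)), mul_comm]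
      exact mul_le_mul_of_nonneg_right (cutoff_le a j y) (by positivity))
  have hmn := hμ.tendsto (fun y => 1 + y ^ 2) 1 (by fun_prop) (fun y => by
    rw [abs_of_nonneg (by positivity), one_mul])
  have ev := (((hcn.const_mul (2 * C)).eventually_lt_const hj).and
    (hmn.eventually_lt_const (show _ < M by linarith))).and
    ((Metric.tendstoUniformlyOn_iff.1 hunif _ hδ).and hb)
  obtain ⟨N, hN⟩ := eventually_atTop.1 ev
  refine ⟨N, fun n hn => ?_⟩
  obtain ⟨⟨e1, e2⟩, e3, e4⟩ := hN n hn.le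
  have iρ := hμ.integrable_seq n
  have ih : Integrable (h n) (μs n) :=
    integrable_of_abs_le_quad iρ (hmeas n).aestronglyMeasurable e4
  have ig : Integrable g (μs n) := integrable_of_abs_le_quad iρ hg.aestronglyMeasurable hgb
  have ic : Integrable (fun y => (1 + y ^ 2) * cutoff a j y) (μs n) :=
    integrable_of_abs_le_quad (C := 1 + k) iρ
      (by have := continuous_cutoff a j
          exact Continuous.aestronglyMeasurable (by fun_prop)) fun y => by
        rw [abs_of_nonneg (mul_nonneg (by positivity) (cutoff_nonneg a j y)), mul_comm]
        exact mul_le_mul_of_nonneg_right (cutoff_le a j y) (by positivity)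
  rw [Real.dist_eq, sub_zero, ← integral_sub ih ig]
  calc |∫ y, (h n y - g y) ∂(μs n)|
      ≤ ∫ y, |h n y - g y| ∂(μs n) := abs_integral_le_integral_abs
    _ ≤ ∫ y, (ε / (2 * M) / 2 * (1 + y ^ 2) + 2 * C * ((1 + y ^ 2) * cutoff a j y)) ∂(μs n) := by
        refine integral_mono (ih.sub ig).abs ((iρ.const_mul _).add (ic.const_mul _)) fun y => ?_
        have hc0 := cutoff_nonneg a j y
        by_cases hy : y ∈ E
        · have := e3 y hy
          rw [dist_comm, Real.dist_eq] at this
          have h1 : 0 ≤ 2 * C * ((1 + y ^ 2) * cutoff a j y) := by positivity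
          have h2 : ε / (2 * M) / 2 * 1 ≤ ε / (2 * M) / 2 * (1 + y ^ 2) :=
            mul_le_mul_of_nonneg_left (by nlinarith [sq_nonneg y]) hδ.le
          simp only
          linarith
        · have h1 := one_le_cutoff a j y hy
          have h2 : |h n y - g y| ≤ 2 * C * (1 + y ^ 2) := by
            have := abs_sub (h n y) (g y)
            linarith [e4 y, hgb y]
          have h3 : 2 * C * ((1 + y ^ 2) * 1) ≤ 2 * C * ((1 + y ^ 2) * cutoff a j y) := by gcongr
          have h4 : 0 ≤ ε / (2 * M) / 2 * (1 + y ^ 2) := by positivity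
          simp only
          linarith
    _ = ε / (2 * M) / 2 * ∫ y, (1 + y ^ 2) ∂(μs n) +
          2 * C * ∫ y, (1 + y ^ 2) * cutoff a j y ∂(μs n) := by
        rw [integral_add (iρ.const_mul _) (ic.const_mul _), integral_const_mul, integral_const_mul]
    _ < ε / (2 * M) / 2 * M + ε / 2 := by
        have := mul_lt_mul_of_pos_left e2 hδ
        linarith
    _ ≤ ε := by
        have : ε / (2 * M) / 2 * M = ε / 4 := by field_simp; norm_num
        linarith

/-! ### Empirical measures -/

/-- The empirical measure of `y 0, …, y (n-1)`; it is zero for `n = 0`. -/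
noncomputable def empirical (y : ℕ → ℝ) (n : ℕ) : Measure ℝ :=
  (n : ℝ≥0∞)⁻¹ • ∑ t ∈ Finset.range n, Measure.dirac (y t)

theorem integrable_sum_dirac (y : ℕ → ℝ) (n : ℕ) (ψ : ℝ → ℝ) :
    Integrable ψ (∑ t ∈ Finset.range n, Measure.dirac (y t)) :=
  integrable_finsetSum_measure.2 fun t _ => integrable_dirac (by simp)

theorem integrable_empirical (y : ℕ → ℝ) (n : ℕ) (ψ : ℝ → ℝ) : Integrable ψ (empirical y n) := by
  rcases n.eq_zero_or_pos with rfl | hn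
  · simp [empirical]
  · exact (integrable_sum_dirac y n ψ).smul_measure
      (ENNReal.inv_ne_top.2 (by exact_mod_cast hn.ne'))

theorem integral_empirical (y : ℕ → ℝ) (n : ℕ) (ψ : ℝ → ℝ) :
    ∫ x, ψ x ∂(empirical y n) = 1 / (n : ℝ) * ∑ t ∈ Finset.range n, ψ (y t) := by
  unfold empirical
  rw [integral_smul_measure, integral_finsetSum_measure fun t _ => integrable_dirac (by simp)]
  simp [integral_dirac]

/-- The strong law of large numbers for a function of an i.i.d. sample. -/
theorem ae_tendsto_average {Ω : Type*} [MeasurableSpace Ω] {P : Measure Ω} [IsProbabilityMeasure P]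
    {ν : Measure ℝ} {Y : ℕ → Ω → ℝ} (hYlaw : ∀ t, HasLaw (Y t) ν P) (hYindep : iIndepFun Y P)
    {ψ : ℝ → ℝ} (hψ : Measurable ψ) (hi : Integrable ψ ν) :
    ∀ᵐ ω ∂P, Tendsto (fun n => ∫ x, ψ x ∂(empirical (fun t => Y t ω) n)) atTop
      (𝓝 (∫ x, ψ x ∂ν)) := by
  have hid : ∀ i, IdentDistrib (fun ω => ψ (Y i ω)) (fun ω => ψ (Y 0 ω)) P P := fun i =>
    (IdentDistrib.mk (hYlaw i).aemeasurable (hYlaw 0).aemeasurable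
      ((hYlaw i).map_eq.trans (hYlaw 0).map_eq.symm)).comp hψ
  have hint : Integrable (fun ω => ψ (Y 0 ω)) P := by
    rw [← (hYlaw 0).map_eq] at hi
    exact hi.comp_aemeasurable (hYlaw 0).aemeasurable
  have hmean : ∫ ω, ψ (Y 0 ω) ∂P = ∫ x, ψ x ∂ν := by
    rw [← (hYlaw 0).map_eq, integral_map (hYlaw 0).aemeasurable hψ.aestronglyMeasurable]
  have := strong_law_ae_real (fun i ω => ψ (Y i ω)) hint
    (fun i j hij => (hYindep.indepFun hij).comp hψ hψ) hid
  filter_upwards [this] with ω hω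
  rw [hmean] at hω
  refine hω.congr fun n => ?_
  rw [integral_empirical]
  ring

/-- Almost surely the empirical measures converge, together with their second moments. The open-set
criterion only has to be checked on finite unions of rational intervals, which makes the
exceptional null set a countable union. -/
theorem ae_quadConv_empirical {Ω : Type*} [MeasurableSpace Ω] {P : Measure Ω}
    [IsProbabilityMeasure P] {ν : Measure ℝ} [IsFiniteMeasure ν] {Y : ℕ → Ω → ℝ}
    (hYlaw : ∀ t, HasLaw (Y t) ν P) (hYindep : iIndepFun Y P)
    (hν : Integrable (fun y : ℝ => 1 + y ^ 2) ν) :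
    ∀ᵐ ω ∂P, QuadConv (empirical fun t => Y t ω) ν := by
  let U : Finset (ℚ × ℚ) → Set ℝ := fun S => ⋃ q ∈ S, Set.Ioo (q.1 : ℝ) q.2
  have hU : ∀ S, MeasurableSet (U S) := fun S =>
    S.measurableSet_biUnion fun q _ => measurableSet_Ioo
  have h1 : ∀ᵐ ω ∂P, ∀ S, Tendsto
      (fun n => ∫ x, (U S).indicator (fun _ => (1 : ℝ)) x ∂(empirical (fun t => Y t ω) n)) atTop
      (𝓝 (∫ x, (U S).indicator (fun _ => (1 : ℝ)) x ∂ν)) :=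
    ae_all_iff.2 fun S => ae_tendsto_average hYlaw hYindep
      (measurable_const.indicator (hU S)) ((integrable_const _).indicator (hU S))
  filter_upwards [h1, ae_tendsto_average hYlaw hYindep (by fun_prop) hν] with ω a1 a2
  refine quadConv_of_isOpen (fun n => integrable_empirical _ _ _) hν (fun G hG => ?_) a2
  have hfin : ∀ n S, empirical (fun t => Y t ω) n S ≠ ∞ := by
    intro n S
    have : IsFiniteMeasure (empirical (fun t => Y t ω) n) := by
      have := integrable_empirical (fun t => Y t ω) n (fun _ => (1 : ℝ))
      exact (integrable_const_iff_isFiniteMeasure one_ne_zero).1 this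
    exact measure_ne_top _ _
  have hconv : ∀ S, Tendsto (fun n => empirical (fun t => Y t ω) n (U S)) atTop (𝓝 (ν (U S))) := by
    intro S
    have := a1 S
    simp only [integral_indicator (hU S), setIntegral_const, smul_eq_mul, mul_one] at this
    exact (ENNReal.tendsto_toReal_iff (fun n => hfin n _) (measure_ne_top _ _)).1 this
  have hGU : G = ⋃ S : {S : Finset (ℚ × ℚ) // U S ⊆ G}, U S := by
    refine Set.Subset.antisymm (fun y hy => ?_) (Set.iUnion_subset fun S => S.2)
    obtain ⟨V, hV, hyV, hVG⟩ := Real.isTopologicalBasis_Ioo_rat.exists_subset_of_mem_open hy hG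
    simp only [Set.mem_iUnion, Set.mem_singleton_iff] at hV
    obtain ⟨p, q, _, rfl⟩ := hV
    refine Set.mem_iUnion.2 ⟨⟨{(p, q)}, ?_⟩, ?_⟩
    · simpa [U] using hVG
    · simpa [U] using hyV
  have hdir : Directed (· ⊆ ·) fun S : {S : Finset (ℚ × ℚ) // U S ⊆ G} => U S := by
    classical
    have hun : ∀ S T, U (S ∪ T) = U S ∪ U T := fun S T => by
      simp only [U, Finset.set_biUnion_union]
    rintro ⟨S, hS⟩ ⟨T, hT⟩
    refine ⟨⟨S ∪ T, ?_⟩, ?_, ?_⟩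
    · rw [hun]; exact Set.union_subset hS hT
    · simp only [hun]; exact Set.subset_union_left
    · simp only [hun]; exact Set.subset_union_right
  calc ν G = ⨆ S : {S : Finset (ℚ × ℚ) // U S ⊆ G}, ν (U S) := by
        conv_lhs => rw [hGU]
        exact hdir.measure_iUnion
    _ ≤ _ := by
        refine iSup_le fun S => ?_
        rw [← (hconv S.1).liminf_eq]
        exact liminf_le_liminf (Eventually.of_forall fun n => measure_mono S.2)

/-! ### Least squares over the simplex in a Hilbert space -/

section Hilbert

variable {E : Type*} [NormedAddCommGroup E] [InnerProductSpace ℝ E]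

/-- First-order optimality: moving mass from `i` to `j` does not decrease the distance. -/
theorem inner_residual_sub_le_zero {k : ℕ} {x : E} {a : Fin k → E} {w : Fin k → ℝ}
    (hw : w ∈ stdSimplex ℝ (Fin k))
    (hmin : ∀ w' ∈ stdSimplex ℝ (Fin k), ‖x - ∑ l, w l • a l‖ ≤ ‖x - ∑ l, w' l • a l‖)
    {i : Fin k} (hi : 0 < w i) (j : Fin k) :
    inner ℝ (x - ∑ l, w l • a l) (a j - a i) ≤ 0 := by
  rcases eq_or_ne i j with rfl | hij
  · simp
  set r := x - ∑ l, w l • a l with hr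
  set d := a j - a i with hd
  by_contra! hpos
  -- `t` keeps the weights nonnegative and makes the gain `2 t ⟪r, d⟫` exceed the loss `t² ‖d‖²`
  set t := min (w i) (inner ℝ r d / (‖d‖ ^ 2 + 1)) with ht
  have ht0 : 0 < t := lt_min hi (by positivity)
  have hsum : ∑ l, (w + t • (Pi.single j 1 - Pi.single i 1 : Fin k → ℝ)) l • a l =
      (∑ l, w l • a l) + t • d := by
    simp [add_smul, Finset.sum_add_distrib, mul_smul, sub_smul, Finset.sum_sub_distrib,
      ← Finset.smul_sum, hd, Pi.single_apply]
  have hmem : w + t • (Pi.single j 1 - Pi.single i 1 : Fin k → ℝ) ∈ stdSimplex ℝ (Fin k) := by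
    refine ⟨fun l => ?_, ?_⟩
    · rcases eq_or_ne l i with rfl | hl
      · have : t ≤ w l := min_le_left _ _
        simp [Pi.single_eq_of_ne hij]
        linarith
      · have h1 : 0 ≤ w l := hw.1 l
        rcases eq_or_ne l j with rfl | hl'
        · simp [Pi.single_eq_of_ne hl]; linarith
        · simpa [Pi.single_eq_of_ne hl, Pi.single_eq_of_ne hl'] using h1
    · simp [Finset.sum_add_distrib, ← Finset.mul_sum, hw.2]
  have h1 := hmin _ hmem
  rw [hsum, ← sub_sub, ← hr] at h1
  have h2 : ‖r‖ ^ 2 ≤ ‖r - t • d‖ ^ 2 := pow_le_pow_left₀ (norm_nonneg _) h1 2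
  rw [norm_sub_sq_real r, inner_smul_right, norm_smul, mul_pow, Real.norm_eq_abs, sq_abs] at h2
  have h3 : t * (‖d‖ ^ 2 + 1) ≤ inner ℝ r d :=
    (le_div_iff₀ (by positivity)).1 (min_le_right _ _)
  nlinarith

/-- The size of a minimizing weight, for components with nonnegative inner products. -/
theorem weight_mul_norm_sq_le {k : ℕ} {x : E} {a : Fin k → E} {w : Fin k → ℝ}
    (hw : w ∈ stdSimplex ℝ (Fin k))
    (hmin : ∀ w' ∈ stdSimplex ℝ (Fin k), ‖x - ∑ l, w l • a l‖ ≤ ‖x - ∑ l, w' l • a l‖)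
    (hnn : ∀ i j, 0 ≤ inner ℝ (a i) (a j)) {i : Fin k} {B : ℝ} (hB : 0 ≤ B)
    (hx : inner ℝ x (a i) ≤ B) (j : Fin k) :
    w i * ‖a i‖ ^ 2 ≤ B + ‖x - a j‖ * ‖a j‖ := by
  rcases (hw.1 i).eq_or_lt with h0 | hi
  · rw [← h0]; simp; positivity
  have h1 := inner_residual_sub_le_zero hw hmin hi j
  have h2 : w i * ‖a i‖ ^ 2 ≤ inner ℝ (∑ l, w l • a l) (a i) := by
    rw [sum_inner, ← real_inner_self_eq_norm_sq, ← real_inner_smul_left]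
    exact Finset.single_le_sum (f := fun l => inner ℝ (w l • a l) (a i))
      (fun l _ => by rw [real_inner_smul_left]; exact mul_nonneg (hw.1 l) (hnn l i))
      (Finset.mem_univ i)
  have h3 : ‖x - ∑ l, w l • a l‖ ≤ ‖x - a j‖ := by
    simpa [Pi.single_apply] using hmin _ (single_mem_stdSimplex ℝ j)
  have h4 := neg_le_of_abs_le (abs_real_inner_le_norm (x - ∑ l, w l • a l) (a j))
  have h5 : ‖x - ∑ l, w l • a l‖ * ‖a j‖ ≤ ‖x - a j‖ * ‖a j‖ := by gcongr
  have h6 : inner ℝ (x - ∑ l, w l • a l) (a i) = inner ℝ x (a i) - inner ℝ (∑ l, w l • a l) (a i) :=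
    inner_sub_left _ _ _
  rw [inner_sub_right] at h1
  linarith

variable {ι : Type*}

/-- The quadratic form of a matrix indexed by a finite set. -/
def quadForm {S : Finset ι} (K : Matrix S S ℝ) (w : ι → ℝ) : ℝ :=
  ∑ i : S, ∑ j : S, w i * w j * K i j

theorem quadForm_parallelogram {S : Finset ι} (K : Matrix S S ℝ) (v w : ι → ℝ) :
    quadForm K (v + w) + quadForm K (v - w) = 2 * quadForm K v + 2 * quadForm K w := by
  simp only [quadForm, Finset.mul_sum, ← Finset.sum_add_distrib, Pi.add_apply, Pi.sub_apply]
  exact Finset.sum_congr rfl fun i _ => Finset.sum_congr rfl fun j _ => by ring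

theorem quadForm_smul {S : Finset ι} (K : Matrix S S ℝ) (c : ℝ) (w : ι → ℝ) :
    quadForm K (c • w) = c ^ 2 * quadForm K w := by
  simp only [quadForm, Finset.mul_sum, Pi.smul_apply, smul_eq_mul]
  exact Finset.sum_congr rfl fun i _ => Finset.sum_congr rfl fun j _ => by ring

theorem quadForm_congr {S : Finset ι} (K : Matrix S S ℝ) {v w : ι → ℝ} (h : ∀ i ∈ S, v i = w i) :
    quadForm K v = quadForm K w :=
  Finset.sum_congr rfl fun i _ => Finset.sum_congr rfl fun j _ => by rw [h i i.2, h j j.2]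

theorem tendsto_norm_sq_sum {S : Finset ι} {a : ℕ → ι → E} {K : Matrix S S ℝ}
    (hK : ∀ i j : S, Tendsto (fun n => (inner ℝ (a n i) (a n j) : ℝ)) atTop (𝓝 (K i j)))
    {w : ℕ → ι → ℝ} {v : ι → ℝ} (hw : Tendsto w atTop (𝓝 v)) :
    Tendsto (fun n => ‖∑ i : S, w n i • a n i‖ ^ 2) atTop (𝓝 (quadForm K v)) := by
  have hwi : ∀ i, Tendsto (fun n => w n i) atTop (𝓝 (v i)) := tendsto_pi_nhds.1 hw
  have : ∀ n, ‖∑ i : S, w n i • a n i‖ ^ 2 =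
      ∑ i : S, ∑ j : S, w n i * w n j * inner ℝ (a n i) (a n j) := by
    intro n
    rw [← real_inner_self_eq_norm_sq, sum_inner]
    refine Finset.sum_congr rfl fun i _ => ?_
    rw [inner_sum]
    refine Finset.sum_congr rfl fun j _ => ?_
    rw [real_inner_smul_left, real_inner_smul_right]
    ring
  simp only [this]
  exact tendsto_finsetSum _ fun i _ => tendsto_finsetSum _ fun j _ =>
    ((hwi i).mul (hwi j)).mul (hK i j)

/-- A limit of Gram matrices is positive semidefinite. -/
theorem quadForm_nonneg_of_tendsto {S : Finset ι} {a : ℕ → ι → E} {K : Matrix S S ℝ}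
    (hK : ∀ i j : S, Tendsto (fun n => (inner ℝ (a n i) (a n j) : ℝ)) atTop (𝓝 (K i j)))
    (v : ι → ℝ) : 0 ≤ quadForm K v :=
  ge_of_tendsto' (tendsto_norm_sq_sum hK (w := fun _ => v) tendsto_const_nhds)
    fun _ => by positivity

/-- Limit of the squared distance to combinations of vectors of which some converge (`S₀`), some
converge weakly to zero with converging Gram matrix (`S₁`), and the others contribute nothing. The
cross terms of the second kind vanish in the limit, and their Gram form remains. -/
theorem tendsto_norm_sub_sum_sq [Fintype ι] [DecidableEq ι] {S₀ S₁ : Finset ι}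
    (hdisj : Disjoint S₀ S₁) {x : ℕ → E} {x₀ : E} (hx : Tendsto x atTop (𝓝 x₀))
    {a : ℕ → ι → E} {b : ι → E} (h₀ : ∀ i ∈ S₀, Tendsto (fun n => a n i) atTop (𝓝 (b i)))
    (h₁x : ∀ i ∈ S₁, Tendsto (fun n => (inner ℝ x₀ (a n i) : ℝ)) atTop (𝓝 0))
    (h₁b : ∀ i ∈ S₁, ∀ j ∈ S₀, Tendsto (fun n => (inner ℝ (b j) (a n i) : ℝ)) atTop (𝓝 0))
    {K : Matrix S₁ S₁ ℝ}
    (hK : ∀ i j : S₁, Tendsto (fun n => (inner ℝ (a n i) (a n j) : ℝ)) atTop (𝓝 (K i j)))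
    {w : ℕ → ι → ℝ} {v : ι → ℝ} (hw : Tendsto w atTop (𝓝 v))
    (hrest : ∀ i, i ∉ S₀ → i ∉ S₁ → Tendsto (fun n => w n i • a n i) atTop (𝓝 0)) :
    Tendsto (fun n => ‖x n - ∑ i, w n i • a n i‖ ^ 2) atTop
      (𝓝 (‖x₀ - ∑ i ∈ S₀, v i • b i‖ ^ 2 + quadForm K v)) := by
  have hwi : ∀ i, Tendsto (fun n => w n i) atTop (𝓝 (v i)) := tendsto_pi_nhds.1 hw
  set z₀ := x₀ - ∑ i ∈ S₀, v i • b i with hz₀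
  let z : ℕ → E := fun n => x n - ∑ i ∈ S₀, w n i • a n i - ∑ i ∈ (S₀ ∪ S₁)ᶜ, w n i • a n i
  let s : ℕ → E := fun n => ∑ i : S₁, w n i • a n i
  have hz : Tendsto z atTop (𝓝 z₀) := by
    have e1 : Tendsto (fun n => ∑ i ∈ (S₀ ∪ S₁)ᶜ, w n i • a n i) atTop (𝓝 0) := by
      have := tendsto_finsetSum (f := fun i n => w n i • a n i) (a := fun _ => (0 : E)) (S₀ ∪ S₁)ᶜ
        fun i hi => by
          simp only [Finset.mem_compl, Finset.mem_union, not_or] at hi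
          exact hrest i hi.1 hi.2
      simpa using this
    have e2 : Tendsto (fun n => ∑ i ∈ S₀, w n i • a n i) atTop (𝓝 (∑ i ∈ S₀, v i • b i)) :=
      tendsto_finsetSum _ fun i hi => (hwi i).smul (h₀ i hi)
    simpa only [sub_zero] using (hx.sub e2).sub e1
  have hs := tendsto_norm_sq_sum hK hw
  have hsn : Tendsto (fun n => ‖s n‖) atTop (𝓝 √(quadForm K v)) := by
    simpa [s, Real.sqrt_sq] using hs.sqrt
  have hcross : Tendsto (fun n => (inner ℝ (z n) (s n) : ℝ)) atTop (𝓝 0) := by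
    have c1 : Tendsto (fun n => (inner ℝ (z n - z₀) (s n) : ℝ)) atTop (𝓝 0) := by
      refine squeeze_zero_norm (fun n => norm_inner_le_norm _ _) ?_
      have : Tendsto (fun n => z n - z₀) atTop (𝓝 0) := by
        simpa using hz.sub_const z₀
      simpa using this.norm.mul hsn
    have c2 : Tendsto (fun n => (inner ℝ z₀ (s n) : ℝ)) atTop (𝓝 0) := by
      have : Tendsto (fun n => ∑ i : S₁, w n i * (inner ℝ z₀ (a n i) : ℝ)) atTop
          (𝓝 (∑ i : S₁, v i * 0)) := by
        refine tendsto_finsetSum _ fun i _ => (hwi i).mul ?_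
        have hb : Tendsto (fun n => ∑ j ∈ S₀, v j * (inner ℝ (b j) (a n i) : ℝ)) atTop
            (𝓝 (∑ j ∈ S₀, v j * 0)) :=
          tendsto_finsetSum _ fun j hj => (h₁b i i.2 j hj).const_mul _
        have := (h₁x i i.2).sub hb
        simpa [hz₀, inner_sub_left, sum_inner, real_inner_smul_left] using this
      simpa [s, inner_sum, real_inner_smul_right] using this
    simpa [inner_sub_left] using c1.add c2
  have hsplit : ∀ n, x n - ∑ i, w n i • a n i = z n - s n := by
    intro n
    have e1 : ∑ i, w n i • a n i =
        (∑ i ∈ S₀, w n i • a n i + ∑ i ∈ S₁, w n i • a n i) +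
          ∑ i ∈ (S₀ ∪ S₁)ᶜ, w n i • a n i := by
      rw [← Finset.sum_union hdisj, Finset.sum_add_sum_compl]
    have e2 : s n = ∑ i ∈ S₁, w n i • a n i := Finset.sum_coe_sort S₁ fun i => w n i • a n i
    rw [e1, e2]
    simp only [z]
    abel
  have := ((hz.norm.pow 2).sub (hcross.const_mul 2)).add hs
  simp only [mul_zero, sub_zero] at this
  refine this.congr fun n => ?_
  rw [hsplit, norm_sub_sq_real (z n)]

/-- Strict convexity: the fitted vector of a minimizer over a convex set is unique. -/
theorem sum_smul_eq_of_isMinOn {S₀ S₁ : Finset ι} {x : E} {b : ι → E} {K : Matrix S₁ S₁ ℝ}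
    (hK : ∀ v, 0 ≤ quadForm K v) {D : Set (ι → ℝ)} (hD : Convex ℝ D) {u v : ι → ℝ}
    (hu : u ∈ D) (hv : v ∈ D)
    (hminu : IsMinOn (fun w => ‖x - ∑ i ∈ S₀, w i • b i‖ ^ 2 + quadForm K w) D u)
    (hminv : IsMinOn (fun w => ‖x - ∑ i ∈ S₀, w i • b i‖ ^ 2 + quadForm K w) D v) :
    ∑ i ∈ S₀, u i • b i = ∑ i ∈ S₀, v i • b i := by
  -- the midpoint would be strictly better if the two fits differed
  have hm : (1 / 2 : ℝ) • u + (1 / 2 : ℝ) • v ∈ D :=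
    hD hu hv (by norm_num) (by norm_num) (by norm_num)
  have h1 : ‖x - ∑ i ∈ S₀, u i • b i‖ ^ 2 + quadForm K u ≤
      ‖x - ∑ i ∈ S₀, ((1 / 2 : ℝ) • u + (1 / 2 : ℝ) • v) i • b i‖ ^ 2 +
        quadForm K ((1 / 2 : ℝ) • u + (1 / 2 : ℝ) • v) := hminu hm
  have h2 : ‖x - ∑ i ∈ S₀, v i • b i‖ ^ 2 + quadForm K v ≤
      ‖x - ∑ i ∈ S₀, ((1 / 2 : ℝ) • u + (1 / 2 : ℝ) • v) i • b i‖ ^ 2 +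
        quadForm K ((1 / 2 : ℝ) • u + (1 / 2 : ℝ) • v) := hminv hm
  have hsum : ∑ i ∈ S₀, ((1 / 2 : ℝ) • u + (1 / 2 : ℝ) • v) i • b i =
      (1 / 2 : ℝ) • (∑ i ∈ S₀, u i • b i) + (1 / 2 : ℝ) • ∑ i ∈ S₀, v i • b i := by
    simp [add_smul, Finset.sum_add_distrib, mul_smul, Finset.smul_sum]
  have hq := quadForm_parallelogram K ((1 / 2 : ℝ) • u) ((1 / 2 : ℝ) • v)
  have hq0 := hK ((1 / 2 : ℝ) • u - (1 / 2 : ℝ) • v)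
  rw [quadForm_smul, quadForm_smul] at hq
  rw [hsum] at h1 h2
  set p := ∑ i ∈ S₀, u i • b i
  set q := ∑ i ∈ S₀, v i • b i
  have hpar := parallelogram_law_with_norm ℝ ((1 / 2 : ℝ) • (x - p)) ((1 / 2 : ℝ) • (x - q))
  have e1 : (1 / 2 : ℝ) • (x - p) + (1 / 2 : ℝ) • (x - q) =
      x - ((1 / 2 : ℝ) • p + (1 / 2 : ℝ) • q) := by module
  have e2 : (1 / 2 : ℝ) • (x - p) - (1 / 2 : ℝ) • (x - q) = (1 / 2 : ℝ) • (q - p) := by module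
  rw [e1, e2] at hpar
  simp only [norm_smul, Real.norm_eq_abs] at hpar
  rw [abs_of_pos (by norm_num : (0 : ℝ) < 1 / 2)] at hpar
  have : ‖q - p‖ ^ 2 ≤ 0 := by nlinarith
  have h0 : ‖q - p‖ = 0 := by nlinarith [norm_nonneg (q - p)]
  exact (sub_eq_zero.1 (norm_eq_zero.1 h0)).symm

/-- A minimizer puts mass on a component that converges and correlates positively with the target:
otherwise a small shift of mass to that component lowers the objective. -/
theorem exists_ne_zero_of_isMinOn [DecidableEq ι] {S₀ S₁ : Finset ι} (hdisj : Disjoint S₀ S₁)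
    {x : E} {b : ι → E} {K : Matrix S₁ S₁ ℝ} (hK : ∀ v, 0 ≤ quadForm K v) {D : Set (ι → ℝ)}
    (hD : Convex ℝ D) {u : ι → ℝ} (hu : u ∈ D)
    (hmin : IsMinOn (fun w => ‖x - ∑ i ∈ S₀, w i • b i‖ ^ 2 + quadForm K w) D u)
    {j : ι} (hj : j ∈ S₀) (hjD : Pi.single j 1 ∈ D) (hpos : 0 < (inner ℝ x (b j) : ℝ)) :
    ∃ i ∈ S₀, u i ≠ 0 := by
  by_contra! hzero
  set c : ℝ := inner ℝ x (b j) with hc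
  -- `ε` keeps a convex combination and makes the gain `2 ε c` exceed the loss `ε² ‖b j‖²`
  set ε : ℝ := min 1 (c / (‖b j‖ ^ 2 + 1)) with hε
  have hε0 : 0 < ε := lt_min one_pos (by positivity)
  have hε1 : ε ≤ 1 := min_le_left _ _
  have hm : (1 - ε) • u + ε • (Pi.single j 1 : ι → ℝ) ∈ D :=
    hD hu hjD (by linarith) hε0.le (by ring)
  have h1 : ‖x - ∑ i ∈ S₀, u i • b i‖ ^ 2 + quadForm K u ≤
      ‖x - ∑ i ∈ S₀, ((1 - ε) • u + ε • (Pi.single j 1 : ι → ℝ)) i • b i‖ ^ 2 +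
        quadForm K ((1 - ε) • u + ε • (Pi.single j 1 : ι → ℝ)) := hmin hm
  have e1 : ∑ i ∈ S₀, u i • b i = 0 :=
    Finset.sum_eq_zero fun i hi => by rw [hzero i hi, zero_smul]
  have e2 : ∑ i ∈ S₀, ((1 - ε) • u + ε • (Pi.single j 1 : ι → ℝ)) i • b i = ε • b j := by
    rw [Finset.sum_eq_single j]
    · simp [hzero j hj]
    · intro i hi hij
      simp [hzero i hi, Pi.single_eq_of_ne hij]
    · exact fun h => absurd hj h
  have e3 : quadForm K ((1 - ε) • u + ε • (Pi.single j 1 : ι → ℝ)) = (1 - ε) ^ 2 * quadForm K u := by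
    rw [← quadForm_smul]
    refine quadForm_congr K fun i hi => ?_
    have : i ≠ j := fun h => Finset.disjoint_left.1 hdisj hj (h ▸ hi)
    simp [Pi.single_eq_of_ne this]
  rw [e1, e2, e3, sub_zero, norm_sub_sq_real, inner_smul_right, norm_smul, mul_pow,
    Real.norm_eq_abs, sq_abs, ← hc] at h1
  have h2 : ε * (‖b j‖ ^ 2 + 1) ≤ c := (le_div_iff₀ (by positivity)).1 (min_le_right _ _)
  have h3 : (1 - ε) ^ 2 * quadForm K u ≤ 1 * quadForm K u :=
    mul_le_mul_of_nonneg_right (by nlinarith) (hK u)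
  nlinarith

end Hilbert

/-! ### Gaussian densities in `L²` -/

theorem gauss_nonneg (p : ℝ × ℝ) (y : ℝ) : 0 ≤ gauss p y := gaussianPDFReal_nonneg _ _ _

theorem integrable_gauss (p : ℝ × ℝ) : Integrable (gauss p) volume := integrable_gaussianPDFReal _ _

theorem toNNReal_sq_ne_zero {s : ℝ} (h : 0 < s) : Real.toNNReal (s ^ 2) ≠ 0 :=
  (Real.toNNReal_pos.2 (by positivity)).ne'

theorem gauss_pos {p : ℝ × ℝ} (hp : 0 < p.2) (y : ℝ) : 0 < gauss p y :=
  gaussianPDFReal_pos _ _ _ (toNNReal_sq_ne_zero hp)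

theorem integral_gauss {p : ℝ × ℝ} (hp : 0 < p.2) : ∫ y, gauss p y = 1 :=
  integral_gaussianPDFReal_eq_one _ (toNNReal_sq_ne_zero hp)

theorem gauss_eq_sqrt (p : ℝ × ℝ) (y : ℝ) :
    gauss p y = (√(2 * Real.pi * p.2 ^ 2))⁻¹ * Real.exp (-(y - p.1) ^ 2 / (2 * p.2 ^ 2)) := by
  unfold gauss gaussianPDFReal
  rw [Real.coe_toNNReal _ (sq_nonneg _)]

theorem gauss_eq {p : ℝ × ℝ} (hp : 0 < p.2) (y : ℝ) :
    gauss p y = (√(2 * Real.pi) * p.2)⁻¹ * Real.exp (-(y - p.1) ^ 2 / (2 * p.2 ^ 2)) := by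
  rw [gauss_eq_sqrt, Real.sqrt_mul (by positivity), Real.sqrt_sq hp.le]

theorem gauss_le {p : ℝ × ℝ} (hp : 0 < p.2) (y : ℝ) : gauss p y ≤ (√(2 * Real.pi) * p.2)⁻¹ := by
  rw [gauss_eq hp]
  refine mul_le_of_le_one_right (by positivity) (Real.exp_le_one_iff.2 ?_)
  exact div_nonpos_of_nonpos_of_nonneg (by nlinarith [sq_nonneg (y - p.1)]) (by positivity)

theorem continuous_gauss {p : ℝ × ℝ} : Continuous (gauss p) := by
  simp only [funext (gauss_eq_sqrt p)]
  fun_prop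

/-- The value of the `L²` inner product of two Gaussian densities. -/
noncomputable def gaussInner (p q : ℝ × ℝ) : ℝ :=
  (√(2 * Real.pi) * √(p.2 ^ 2 + q.2 ^ 2))⁻¹ *
    Real.exp (-(p.1 - q.1) ^ 2 / (2 * (p.2 ^ 2 + q.2 ^ 2)))

/-- Completing the square: the product of two Gaussian densities is a multiple of a third one. -/
theorem integral_gauss_mul_gauss {p q : ℝ × ℝ} (hp : 0 < p.2) (hq : 0 < q.2) :
    ∫ y, gauss p y * gauss q y = gaussInner p q := by
  have hs : 0 < p.2 ^ 2 + q.2 ^ 2 := by positivity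
  set r : ℝ × ℝ := ((p.1 * q.2 ^ 2 + q.1 * p.2 ^ 2) / (p.2 ^ 2 + q.2 ^ 2),
    p.2 * q.2 / √(p.2 ^ 2 + q.2 ^ 2)) with hr
  have hr2 : 0 < r.2 := by simp only [hr]; positivity
  have hpt : ∀ y, gauss p y * gauss q y = gaussInner p q * gauss r y := by
    intro y
    rw [gauss_eq hp, gauss_eq hq, gauss_eq hr2, gaussInner, mul_mul_mul_comm, ← Real.exp_add,
      mul_mul_mul_comm, ← Real.exp_add]
    congr 1
    · simp only [hr]
      field_simp
    · congr 1
      simp only [hr]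
      rw [div_pow, Real.sq_sqrt hs.le]
      field_simp
      ring
  simp only [hpt]
  rw [integral_const_mul, integral_gauss hr2, mul_one]

/-- The Gaussian density as an element of `L²(ℝ)`. -/
noncomputable def gaussL2 (p : ℝ × ℝ) : Lp ℝ 2 (volume : Measure ℝ) := (memLp_gauss p).toLp _

theorem inner_toLp_eq {φ ψ : ℝ → ℝ} (hφ : MemLp φ 2 volume) (hψ : MemLp ψ 2 volume) :
    (inner ℝ (hφ.toLp φ) (hψ.toLp ψ) : ℝ) = ∫ y, φ y * ψ y := by
  rw [L2.inner_def]
  refine integral_congr_ae ?_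
  filter_upwards [hφ.coeFn_toLp, hψ.coeFn_toLp] with y h1 h2
  rw [h1, h2, real_inner_eq_re_inner, RCLike.inner_apply]
  simp [mul_comm]

theorem inner_gaussL2 {p q : ℝ × ℝ} (hp : 0 < p.2) (hq : 0 < q.2) :
    (inner ℝ (gaussL2 p) (gaussL2 q) : ℝ) = gaussInner p q := by
  rw [gaussL2, gaussL2, inner_toLp_eq, integral_gauss_mul_gauss hp hq]

theorem gaussInner_pos {p q : ℝ × ℝ} (hp : 0 < p.2) : 0 < gaussInner p q := by
  unfold gaussInner; positivity

theorem gaussInner_le {p q : ℝ × ℝ} (hq : 0 < q.2) :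
    gaussInner p q ≤ (√(2 * Real.pi) * q.2)⁻¹ := by
  unfold gaussInner
  calc _ ≤ (√(2 * Real.pi) * √(p.2 ^ 2 + q.2 ^ 2))⁻¹ := by
        refine mul_le_of_le_one_right (by positivity) (Real.exp_le_one_iff.2 ?_)
        exact div_nonpos_of_nonpos_of_nonneg (by nlinarith [sq_nonneg (p.1 - q.1)]) (by positivity)
    _ ≤ _ := by
        gcongr
        exact Real.le_sqrt_of_sq_le (by nlinarith [sq_nonneg p.2])

/-- The squared norm `1 / (2 σ √π)` of a Gaussian density. -/
theorem norm_gaussL2_sq {p : ℝ × ℝ} (hp : 0 < p.2) :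
    ‖gaussL2 p‖ ^ 2 = (2 * √Real.pi * p.2)⁻¹ := by
  have : √(p.2 ^ 2 + p.2 ^ 2) = √2 * p.2 := by
    rw [← two_mul, Real.sqrt_mul (by norm_num), Real.sqrt_sq hp.le]
  rw [← real_inner_self_eq_norm_sq, inner_gaussL2 hp hp, gaussInner, this,
    Real.sqrt_mul (by norm_num)]
  simp only [sub_self, ne_eq, OfNat.ofNat_ne_zero, not_false_eq_true, zero_pow, neg_zero, zero_div,
    Real.exp_zero, mul_one]
  congr 1
  linear_combination √Real.pi * p.2 * Real.mul_self_sqrt (show (0 : ℝ) ≤ 2 by norm_num)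

section Limits

variable {α : Type*} {l : Filter α}

theorem tendsto_gaussInner {p q : α → ℝ × ℝ} {p₀ q₀ : ℝ × ℝ} (hp : Tendsto p l (𝓝 p₀))
    (hq : Tendsto q l (𝓝 q₀)) (h : 0 < p₀.2) :
    Tendsto (fun a => gaussInner (p a) (q a)) l (𝓝 (gaussInner p₀ q₀)) := by
  have hs : Tendsto (fun a => (p a).2 ^ 2 + (q a).2 ^ 2) l (𝓝 (p₀.2 ^ 2 + q₀.2 ^ 2)) :=
    (hp.snd_nhds.pow 2).add (hq.snd_nhds.pow 2)
  refine ((hs.sqrt.const_mul _).inv₀ (by positivity)).mul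
    (Tendsto.rexp (Tendsto.div ?_ (hs.const_mul 2) (by positivity)))
  exact ((hp.fst_nhds.sub hq.fst_nhds).pow 2).neg

theorem tendsto_gaussL2 {p : α → ℝ × ℝ} {p₀ : ℝ × ℝ} (hp : Tendsto p l (𝓝 p₀)) (h : 0 < p₀.2) :
    Tendsto (fun a => gaussL2 (p a)) l (𝓝 (gaussL2 p₀)) := by
  have hev : ∀ᶠ a in l, 0 < (p a).2 := ((continuous_snd.tendsto p₀).comp hp).eventually_const_lt h
  rw [tendsto_iff_norm_sub_tendsto_zero]
  have hsq : Tendsto (fun a => ‖gaussL2 (p a) - gaussL2 p₀‖ ^ 2) l (𝓝 0) := by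
    have h1 := ((tendsto_gaussInner hp hp h).sub
      ((tendsto_gaussInner hp (tendsto_const_nhds (x := p₀)) h).const_mul 2)).add_const
        (gaussInner p₀ p₀)
    have h0 : gaussInner p₀ p₀ - 2 * gaussInner p₀ p₀ + gaussInner p₀ p₀ = 0 := by ring
    rw [h0] at h1
    refine h1.congr' ?_
    filter_upwards [hev] with a ha
    rw [norm_sub_sq_real, ← real_inner_self_eq_norm_sq, ← real_inner_self_eq_norm_sq,
      inner_gaussL2 ha ha, inner_gaussL2 ha h, inner_gaussL2 h h]
  simpa [Real.sqrt_sq] using hsq.sqrt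

theorem tendsto_gaussL2_of_scale_atTop {p : α → ℝ × ℝ} (hp : Tendsto (fun a => (p a).2) l atTop) :
    Tendsto (fun a => gaussL2 (p a)) l (𝓝 0) := by
  rw [tendsto_zero_iff_norm_tendsto_zero]
  have hsq : Tendsto (fun a => ‖gaussL2 (p a)‖ ^ 2) l (𝓝 0) := by
    have h1 : Tendsto (fun a => (2 * √Real.pi * (p a).2)⁻¹) l (𝓝 0) :=
      tendsto_inv_atTop_zero.comp (hp.const_mul_atTop (by positivity))
    refine h1.congr' ?_
    filter_upwards [hp.eventually_gt_atTop 0] with a ha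
    rw [norm_gaussL2_sq ha]
  simpa [Real.sqrt_sq] using hsq.sqrt

theorem tendsto_sq_atTop_of_abs {x : α → ℝ} (hx : Tendsto (fun a => |x a|) l atTop) :
    Tendsto (fun a => x a ^ 2) l atTop := by
  simpa [Function.comp_def] using (tendsto_pow_atTop (two_ne_zero)).comp hx

theorem tendsto_abs_sub_atTop {x y : α → ℝ} {y₀ : ℝ} (hx : Tendsto (fun a => |x a|) l atTop)
    (hy : Tendsto y l (𝓝 y₀)) : Tendsto (fun a => |y a - x a|) l atTop := by
  have h1 : Tendsto (fun a => |x a| + -|y a|) l atTop := hx.atTop_add hy.abs.neg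
  refine tendsto_atTop_mono (fun a => ?_) h1
  have := abs_sub_abs_le_abs_sub (x a) (y a)
  rw [abs_sub_comm] at this
  linarith

theorem tendsto_exp_neg_div {x v : α → ℝ} {v₀ : ℝ} (hx : Tendsto x l atTop)
    (hv : Tendsto v l (𝓝 v₀)) (h : 0 < v₀) : Tendsto (fun a => Real.exp (-x a / v a)) l (𝓝 0) := by
  have h1 : Tendsto (fun a => x a * (v a)⁻¹) l atTop :=
    hx.atTop_mul_pos (inv_pos.2 h) (hv.inv₀ h.ne')
  refine (Real.tendsto_exp_neg_atTop_nhds_zero.comp h1).congr fun a => ?_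
  simp only [Function.comp_apply]
  congr 1
  ring

theorem tendsto_gaussInner_of_mean {p : α → ℝ × ℝ} {s₀ : ℝ}
    (hm : Tendsto (fun a => |(p a).1|) l atTop) (hs : Tendsto (fun a => (p a).2) l (𝓝 s₀))
    (h : 0 < s₀) (q : ℝ × ℝ) : Tendsto (fun a => gaussInner q (p a)) l (𝓝 0) := by
  have h1 : Tendsto (fun a => (√(2 * Real.pi) * √(q.2 ^ 2 + (p a).2 ^ 2))⁻¹) l
      (𝓝 (√(2 * Real.pi) * √(q.2 ^ 2 + s₀ ^ 2))⁻¹) :=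
    ((((hs.pow 2).const_add _).sqrt).const_mul _).inv₀ (by positivity)
  have h2 := tendsto_exp_neg_div
    (tendsto_sq_atTop_of_abs (tendsto_abs_sub_atTop hm (tendsto_const_nhds (x := q.1))))
    (((hs.pow 2).const_add (q.2 ^ 2)).const_mul 2) (by positivity)
  simpa [gaussInner] using h1.mul h2

theorem tendsto_smul_gaussL2_of_scale_zero {p : α → ℝ × ℝ} {w : α → ℝ} {C : ℝ}
    (hpos : ∀ a, 0 < (p a).2) (hs : Tendsto (fun a => (p a).2) l (𝓝 0))
    (hw0 : ∀ᶠ a in l, 0 ≤ w a) (hw : ∀ᶠ a in l, w a ≤ C * (p a).2) :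
    Tendsto (fun a => w a • gaussL2 (p a)) l (𝓝 0) := by
  rw [tendsto_zero_iff_norm_tendsto_zero]
  have hsq : Tendsto (fun a => ‖w a • gaussL2 (p a)‖ ^ 2) l (𝓝 0) := by
    have h1 : Tendsto (fun a => C ^ 2 * (2 * √Real.pi)⁻¹ * (p a).2) l (𝓝 0) := by
      simpa using hs.const_mul (C ^ 2 * (2 * √Real.pi)⁻¹)
    refine squeeze_zero' (Eventually.of_forall fun a => by positivity) ?_ h1
    filter_upwards [hw0, hw] with a a0 a1
    have hp := hpos a
    rw [norm_smul, mul_pow, norm_gaussL2_sq hp, Real.norm_eq_abs, sq_abs]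
    calc w a ^ 2 * (2 * √Real.pi * (p a).2)⁻¹
        ≤ (C * (p a).2) ^ 2 * (2 * √Real.pi * (p a).2)⁻¹ := by gcongr
      _ = _ := by field_simp
  simpa [Real.sqrt_sq] using hsq.sqrt

theorem tendsto_gauss {p : α → ℝ × ℝ} {p₀ : ℝ × ℝ} {y : α → ℝ} {y₀ : ℝ} (hp : Tendsto p l (𝓝 p₀))
    (h : 0 < p₀.2) (hy : Tendsto y l (𝓝 y₀)) :
    Tendsto (fun a => gauss (p a) (y a)) l (𝓝 (gauss p₀ y₀)) := by
  simp only [gauss_eq_sqrt]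
  refine ((((hp.snd_nhds.pow 2).const_mul _).sqrt).inv₀ (by positivity)).mul
    (Tendsto.rexp (Tendsto.div ?_ ((hp.snd_nhds.pow 2).const_mul 2) (by positivity)))
  exact ((hy.sub hp.fst_nhds).pow 2).neg

theorem tendsto_gauss_of_scale_atTop {p : α → ℝ × ℝ} (hp : Tendsto (fun a => (p a).2) l atTop)
    (y : α → ℝ) : Tendsto (fun a => gauss (p a) (y a)) l (𝓝 0) := by
  have h1 : Tendsto (fun a => (√(2 * Real.pi) * (p a).2)⁻¹) l (𝓝 0) :=
    tendsto_inv_atTop_zero.comp (hp.const_mul_atTop (by positivity))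
  refine squeeze_zero' (Eventually.of_forall fun a => gauss_nonneg _ _) ?_ h1
  filter_upwards [hp.eventually_gt_atTop 0] with a ha using gauss_le ha _

theorem tendsto_gauss_of_mean {p : α → ℝ × ℝ} {s₀ : ℝ}
    (hm : Tendsto (fun a => |(p a).1|) l atTop) (hs : Tendsto (fun a => (p a).2) l (𝓝 s₀))
    (h : 0 < s₀) {y : α → ℝ} {y₀ : ℝ} (hy : Tendsto y l (𝓝 y₀)) :
    Tendsto (fun a => gauss (p a) (y a)) l (𝓝 0) := by
  have h1 : Tendsto (fun a => (√(2 * Real.pi * (p a).2 ^ 2))⁻¹) l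
      (𝓝 (√(2 * Real.pi * s₀ ^ 2))⁻¹) :=
    (((hs.pow 2).const_mul _).sqrt).inv₀ (by positivity)
  have h2 := tendsto_exp_neg_div (tendsto_sq_atTop_of_abs (tendsto_abs_sub_atTop hm hy))
    ((hs.pow 2).const_mul 2) (by positivity)
  simpa [gauss_eq_sqrt] using h1.mul h2

/-- A component with vanishing scale and weight of the order of the scale vanishes away from the
limit of its mean. -/
theorem tendsto_mul_gauss_of_scale_zero {p : α → ℝ × ℝ} {w : α → ℝ} {C δ : ℝ} (hδ : 0 < δ)
    (hpos : ∀ a, 0 < (p a).2) (hs : Tendsto (fun a => (p a).2) l (𝓝 0))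
    (hw0 : ∀ᶠ a in l, 0 ≤ w a) (hw : ∀ᶠ a in l, w a ≤ C * (p a).2) {y : α → ℝ}
    (hy : ∀ᶠ a in l, δ ≤ |y a - (p a).1|) :
    Tendsto (fun a => w a * gauss (p a) (y a)) l (𝓝 0) := by
  have hs' : Tendsto (fun a => (2 * (p a).2 ^ 2)⁻¹) l atTop := by
    refine tendsto_inv_nhdsGT_zero.comp (tendsto_nhdsWithin_iff.2 ⟨?_, ?_⟩)
    · simpa using (hs.pow 2).const_mul 2
    · exact Eventually.of_forall fun a => by have := hpos a; simp only [Set.mem_Ioi]; positivity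
  have h1 : Tendsto (fun a => C * (√(2 * Real.pi))⁻¹ * Real.exp (-(δ ^ 2 * (2 * (p a).2 ^ 2)⁻¹))) l
      (𝓝 0) := by
    simpa using (Real.tendsto_exp_neg_atTop_nhds_zero.comp
      (hs'.const_mul_atTop (by positivity : 0 < δ ^ 2))).const_mul (C * (√(2 * Real.pi))⁻¹)
  refine squeeze_zero' ?_ ?_ h1
  · filter_upwards [hw0] with a a0 using mul_nonneg a0 (gauss_nonneg _ _)
  · filter_upwards [hw0, hw, hy] with a a0 a1 a2
    have hp := hpos a
    have hsq : δ ^ 2 ≤ (y a - (p a).1) ^ 2 := by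
      rw [← sq_abs (y a - (p a).1)]; gcongr
    have hC : C * (p a).2 * (√(2 * Real.pi) * (p a).2)⁻¹ = C * (√(2 * Real.pi))⁻¹ := by
      field_simp
    rw [gauss_eq hp, ← hC, ← mul_assoc]
    gcongr
    · exact mul_nonneg (a0.trans a1) (by positivity)
    · rw [← div_eq_mul_inv, neg_div]
      gcongr

end Limits

/-! ### Mixtures -/

theorem continuous_sum_gauss {ι : Type*} (S : Finset ι) (w : ι → ℝ) (q : ι → ℝ × ℝ) :
    Continuous fun y => ∑ i ∈ S, w i * gauss (q i) y :=
  continuous_finsetSum _ fun _ _ => continuous_const.mul continuous_gauss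

theorem continuous_mix {k : ℕ} (w : Fin k → ℝ) (θ : Fin k → ℝ × ℝ) : Continuous (mix w θ) :=
  continuous_sum_gauss _ _ _

theorem coeFn_sum_gaussL2 {ι : Type*} (S : Finset ι) (w : ι → ℝ) (q : ι → ℝ × ℝ) :
    (∑ i ∈ S, w i • gaussL2 (q i) : Lp ℝ 2 (volume : Measure ℝ)) =ᵐ[volume]
      fun y => ∑ i ∈ S, w i * gauss (q i) y := by
  have h1 : ∀ᵐ y ∂(volume : Measure ℝ), ∀ i ∈ S,
      (w i • gaussL2 (q i) : Lp ℝ 2 volume) y = w i * gauss (q i) y := by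
    refine (ae_ball_iff S.countable_toSet).2 fun i _ => ?_
    filter_upwards [Lp.coeFn_smul (w i) (gaussL2 (q i)), (memLp_gauss (q i)).coeFn_toLp] with y h h'
    rw [h, Pi.smul_apply, gaussL2, h', smul_eq_mul]
  filter_upwards [Lp.coeFn_finsetSum S (fun i => w i • gaussL2 (q i)), h1] with y h h'
  rw [h, Finset.sum_apply]
  exact Finset.sum_congr rfl h'

theorem memLp_mix {k : ℕ} (w : Fin k → ℝ) (θ : Fin k → ℝ × ℝ) : MemLp (mix w θ) 2 volume :=
  (memLp_congr_ae (coeFn_sum_gaussL2 Finset.univ w θ)).1 (Lp.memLp _)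

theorem toLp_mix {k : ℕ} (w : Fin k → ℝ) (θ : Fin k → ℝ × ℝ) :
    (memLp_mix w θ).toLp _ = ∑ i, w i • gaussL2 (θ i) :=
  Lp.ext ((memLp_mix w θ).coeFn_toLp.trans (coeFn_sum_gaussL2 Finset.univ w θ).symm)

theorem l2norm_sub_sum_gauss {ι : Type*} (S : Finset ι) {φ : ℝ → ℝ} (hφ : MemLp φ 2 volume)
    (w : ι → ℝ) (q : ι → ℝ × ℝ) :
    l2norm (fun y => φ y - ∑ i ∈ S, w i * gauss (q i) y) =
      ‖hφ.toLp φ - ∑ i ∈ S, w i • gaussL2 (q i)‖ := by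
  rw [Lp.norm_def]
  unfold l2norm
  congr 1
  refine eLpNorm_congr_ae ?_
  filter_upwards [Lp.coeFn_sub (hφ.toLp φ) (∑ i ∈ S, w i • gaussL2 (q i)), hφ.coeFn_toLp,
    coeFn_sum_gaussL2 S w q] with y a b c
  rw [a, Pi.sub_apply, b, c]

theorem IsWeights.norm_le {k : ℕ} {φ : ℝ → ℝ} (hφ : MemLp φ 2 volume) {θ : Fin k → ℝ × ℝ}
    {w : Fin k → ℝ} (h : IsWeights φ θ w) (w' : Fin k → ℝ) (hw' : w' ∈ stdSimplex ℝ (Fin k)) :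
    ‖hφ.toLp φ - ∑ i, w i • gaussL2 (θ i)‖ ≤ ‖hφ.toLp φ - ∑ i, w' i • gaussL2 (θ i)‖ := by
  have : l2norm (fun y => φ y - mix w θ y) ≤ l2norm (fun y => φ y - mix w' θ y) := h.2 hw'
  rwa [← l2norm_sub_sum_gauss, ← l2norm_sub_sum_gauss]

/-- The logarithm of a bounded mixture grows at most quadratically, with a constant that depends
only on an upper bound and on bounds for one of its components. -/
theorem abs_log_sum_gauss_le {ι : Type*} {S : Finset ι} {w : ι → ℝ} {q : ι → ℝ × ℝ}
    {A c s s' m : ℝ} (hw : ∀ i ∈ S, 0 ≤ w i) {y : ℝ} (hA : ∑ i ∈ S, w i * gauss (q i) y ≤ A)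
    {i : ι} (hi : i ∈ S) (hc : 0 < c) (hcw : c ≤ w i) (hs : 0 < s) (hsq : s ≤ (q i).2)
    (hqs : (q i).2 ≤ s') (hm : |(q i).1| ≤ m) :
    |Real.log (∑ i ∈ S, w i * gauss (q i) y)| ≤
      (|Real.log A| + |Real.log (c * (√(2 * Real.pi) * s')⁻¹)| + (1 + m ^ 2) / s ^ 2) *
        (1 + y ^ 2) := by
  have hq : 0 < (q i).2 := hs.trans_le hsq
  have hs' : 0 < s' := hq.trans_le hqs
  set z := ∑ i ∈ S, w i * gauss (q i) y with hz
  have hlow : c * (√(2 * Real.pi) * s')⁻¹ * Real.exp (-((1 + m ^ 2) / s ^ 2 * (1 + y ^ 2))) ≤ z := by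
    refine le_trans ?_ (Finset.single_le_sum (f := fun i => w i * gauss (q i) y)
      (fun j hj => mul_nonneg (hw j hj) (gauss_nonneg _ _)) hi)
    rw [gauss_eq hq, mul_assoc]
    have hexp : -((1 + m ^ 2) / s ^ 2 * (1 + y ^ 2)) ≤ -(y - (q i).1) ^ 2 / (2 * (q i).2 ^ 2) := by
      rw [neg_div, neg_le_neg_iff]
      have hm2 : (q i).1 ^ 2 ≤ m ^ 2 := by rw [← sq_abs]; gcongr
      have hnum : (y - (q i).1) ^ 2 ≤ 2 * ((1 + m ^ 2) * (1 + y ^ 2)) := by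
        nlinarith [sq_nonneg (y + (q i).1), mul_nonneg (sq_nonneg m) (sq_nonneg y)]
      calc (y - (q i).1) ^ 2 / (2 * (q i).2 ^ 2)
          ≤ 2 * ((1 + m ^ 2) * (1 + y ^ 2)) / (2 * s ^ 2) := by gcongr
        _ = (1 + m ^ 2) / s ^ 2 * (1 + y ^ 2) := by field_simp
    have := hw i hi
    gcongr
  have hz0 : 0 < z := lt_of_lt_of_le (by positivity) hlow
  have h1 : Real.log (c * (√(2 * Real.pi) * s')⁻¹) + -((1 + m ^ 2) / s ^ 2 * (1 + y ^ 2)) ≤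
      Real.log z := by
    rw [← Real.log_exp (-((1 + m ^ 2) / s ^ 2 * (1 + y ^ 2))), ← Real.log_mul (by positivity)
      (Real.exp_ne_zero _)]
    exact Real.log_le_log (by positivity) hlow
  have h2 : Real.log z ≤ Real.log A := Real.log_le_log hz0 hA
  have h3 := le_abs_self (Real.log A)
  have h4 := neg_abs_le (Real.log (c * (√(2 * Real.pi) * s')⁻¹))
  have h5 := abs_nonneg (Real.log A)
  have h6 := abs_nonneg (Real.log (c * (√(2 * Real.pi) * s')⁻¹))
  have h7 : 0 ≤ (1 + m ^ 2) / s ^ 2 := by positivity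
  have h8 := sq_nonneg y
  rw [abs_le]
  constructor <;> nlinarith [mul_nonneg h5 h8, mul_nonneg h6 h8, mul_nonneg h7 h8]

/-! ### The true law -/

section Law

variable {k : ℕ} {wstar : Fin k → ℝ} {θstar : Fin k → ℝ × ℝ}

theorem mix_nonneg {w : Fin k → ℝ} (hw : ∀ i, 0 ≤ w i) (θ : Fin k → ℝ × ℝ) (y : ℝ) :
    0 ≤ mix w θ y :=
  Finset.sum_nonneg fun i _ => mul_nonneg (hw i) (gauss_nonneg _ _)

theorem law_absolutelyContinuous (f : ℝ → ℝ) : law f ≪ volume := withDensity_absolutelyContinuous _ _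

theorem integrable_quad_mul_gauss {p : ℝ × ℝ} (hp : 0 < p.2) :
    Integrable (fun y => (1 + y ^ 2) * gauss p y) volume := by
  have h1 : Integrable (fun y : ℝ => 1 + y ^ 2) (gaussianReal p.1 (Real.toNNReal (p.2 ^ 2))) :=
    (integrable_const _).add (memLp_id_gaussianReal 2).integrable_sq
  rw [gaussianReal_of_var_ne_zero _ (toNNReal_sq_ne_zero hp),
    integrable_withDensity_iff (measurable_gaussianPDF _ _)
      (Eventually.of_forall fun _ => gaussianPDF_lt_top)] at h1
  simpa only [toReal_gaussianPDF] using! h1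

theorem integrable_quad_law (hθ : θstar ∈ ThetaO k) (hw : ∀ i, 0 ≤ wstar i) :
    Integrable (fun y : ℝ => 1 + y ^ 2) (law (mix wstar θstar)) := by
  unfold law
  rw [integrable_withDensity_iff (continuous_mix wstar θstar).measurable.ennreal_ofReal
    (Eventually.of_forall fun _ => ENNReal.ofReal_lt_top)]
  have : (fun y : ℝ => (1 + y ^ 2) * (ENNReal.ofReal (mix wstar θstar y)).toReal) =
      fun y => ∑ i, wstar i * ((1 + y ^ 2) * gauss (θstar i) y) := by
    funext y
    rw [ENNReal.toReal_ofReal (mix_nonneg hw _ _), mix, Finset.mul_sum]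
    exact Finset.sum_congr rfl fun i _ => by ring
  rw [this]
  exact integrable_finsetSum _ fun i _ => (integrable_quad_mul_gauss (hθ i)).const_mul _

theorem inner_mix_gaussL2 {p : ℝ × ℝ} (hp : 0 < p.2) (hθ : θstar ∈ ThetaO k) :
    (inner ℝ ((memLp_mix wstar θstar).toLp _) (gaussL2 p) : ℝ) =
      ∑ i, wstar i * gaussInner (θstar i) p := by
  rw [toLp_mix, sum_inner]
  refine Finset.sum_congr rfl fun i _ => ?_
  rw [real_inner_smul_left, inner_gaussL2 (hθ i) hp]

/-- `ln` of a fitted mixture is integrable for the true law. -/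
theorem integrable_log_fit (hθ : θstar ∈ ThetaO k) (hw : ∀ i, 0 ≤ wstar i) (hk : 0 < k)
    {θ : Fin k → ℝ × ℝ} (h : θ ∈ ThetaO k) :
    Integrable (fun y => Real.log (fit (mix wstar θstar) θ y)) (law (mix wstar θstar)) := by
  obtain ⟨hv, -⟩ := isWeights_weights hk (memLp_mix wstar θstar) θ
  set v := weights (mix wstar θstar) θ with hvdef
  have hex : ∃ i, 0 < v i := by
    by_contra! hcon
    have := Finset.sum_nonpos fun i (_ : i ∈ Finset.univ) => hcon i
    rw [hv.2] at this
    linarith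
  obtain ⟨i, hi⟩ := hex
  have hb := fun y => abs_log_sum_gauss_le (y := y) (A := ∑ j, v j * (√(2 * Real.pi) * (θ j).2)⁻¹)
    (fun j _ => hv.1 j)
    (Finset.sum_le_sum fun j _ => mul_le_mul_of_nonneg_left (gauss_le (h j) y) (hv.1 j))
    (Finset.mem_univ i) hi le_rfl (h i) le_rfl le_rfl le_rfl
  exact integrable_of_abs_le_quad (integrable_quad_law hθ hw)
    (continuous_mix v θ).measurable.log.aestronglyMeasurable hb

end Law

/-! ### Expected logarithms -/

theorem expLog_congr {P : Measure ℝ} {φ ψ : ℝ → ℝ} (h : φ =ᵐ[P] ψ) : expLog P φ = expLog P ψ := by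
  unfold expLog
  have h1 : ∀ F : EReal → ℝ≥0∞, ∫⁻ y, F (ENNReal.log (ENNReal.ofReal (φ y))) ∂P =
      ∫⁻ y, F (ENNReal.log (ENNReal.ofReal (ψ y))) ∂P := fun F =>
    lintegral_congr_ae (by filter_upwards [h] with y hy; rw [hy])
  rw [h1 EReal.toENNReal, h1 fun x => (-x).toENNReal]

theorem expLog_eq_integral {P : Measure ℝ} {φ : ℝ → ℝ} (hφ : ∀ y, 0 < φ y)
    (hi : Integrable (fun y => Real.log (φ y)) P) :
    expLog P φ = ((∫ y, Real.log (φ y) ∂P : ℝ) : EReal) := by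
  unfold expLog
  simp only [ENNReal.log_ofReal_of_pos (hφ _), ← EReal.coe_neg, EReal.toENNReal_of_ne_top
    (EReal.coe_ne_top _), EReal.toReal_coe]
  rw [integral_eq_lintegral_pos_part_sub_lintegral_neg_part hi, EReal.coe_sub,
    EReal.coe_ennreal_toReal, EReal.coe_ennreal_toReal]
  · exact (lt_top_iff_ne_top.1 hi.neg.lintegral_lt_top)
  · exact (lt_top_iff_ne_top.1 hi.lintegral_lt_top)

/-! ### Limits in the compactified parameter space -/

section Compactification

variable {k : ℕ} {θn : ℕ → Fin k → ℝ × ℝ} {θ : Fin k → EReal × ℝ≥0∞}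

/-- The real parameters of a component; junk unless the component belongs to `I0`. -/
noncomputable def realParam (θ : Fin k → EReal × ℝ≥0∞) (i : Fin k) : ℝ × ℝ :=
  ((θ i).1.toReal, (θ i).2.toReal)

theorem disjoint_I0_I1 : Disjoint (I0 θ) (I1 θ) := by
  rw [Finset.disjoint_left]
  intro i h0 h1
  simp only [I0, I1, Finset.mem_filter, Finset.mem_univ, true_and] at h0 h1
  tauto

theorem tendsto_scale (hmem : ∀ n, θn n ∈ ThetaO k)
    (h : Tendsto (fun n => emb (θn n)) atTop (𝓝 θ)) {i : Fin k} (hi : (θ i).2 ≠ ⊤) :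
    Tendsto (fun n => (θn n i).2) atTop (𝓝 (θ i).2.toReal) := by
  have h1 := ((tendsto_pi_nhds.1 h) i).snd_nhds
  refine ((ENNReal.tendsto_toReal hi).comp h1).congr fun n => ?_
  simp [emb, ENNReal.toReal_ofReal (hmem n i).le]

theorem tendsto_scale_atTop (h : Tendsto (fun n => emb (θn n)) atTop (𝓝 θ)) {i : Fin k}
    (hi : (θ i).2 = ⊤) : Tendsto (fun n => (θn n i).2) atTop atTop := by
  have h1 := ((tendsto_pi_nhds.1 h) i).snd_nhds
  rw [hi] at h1
  exact ENNReal.tendsto_ofReal_nhds_top.1 h1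

theorem tendsto_mean (h : Tendsto (fun n => emb (θn n)) atTop (𝓝 θ)) {i : Fin k}
    (h1 : (θ i).1 ≠ ⊥) (h2 : (θ i).1 ≠ ⊤) :
    Tendsto (fun n => (θn n i).1) atTop (𝓝 (θ i).1.toReal) :=
  (EReal.tendsto_toReal h2 h1).comp ((tendsto_pi_nhds.1 h) i).fst_nhds

theorem tendsto_abs_mean (h : Tendsto (fun n => emb (θn n)) atTop (𝓝 θ)) {i : Fin k}
    (hi : (θ i).1 = ⊥ ∨ (θ i).1 = ⊤) : Tendsto (fun n => |(θn n i).1|) atTop atTop := by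
  have h1 := ((tendsto_pi_nhds.1 h) i).fst_nhds
  rcases hi with hi | hi <;> rw [hi] at h1
  · exact tendsto_abs_atBot_atTop.comp (EReal.tendsto_coe_nhds_bot_iff.1 h1)
  · exact tendsto_abs_atTop_atTop.comp (EReal.tendsto_coe_nhds_top_iff.1 h1)

theorem scale_pos {i : Fin k} (h0 : (θ i).2 ≠ 0) (h1 : (θ i).2 ≠ ⊤) : 0 < (θ i).2.toReal :=
  ENNReal.toReal_pos h0 h1

theorem realParam_pos {i : Fin k} (hi : i ∈ I0 θ) : 0 < (realParam θ i).2 := by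
  simp only [I0, Finset.mem_filter, Finset.mem_univ, true_and] at hi
  exact scale_pos hi.1.1 hi.1.2

theorem tendsto_realParam (hmem : ∀ n, θn n ∈ ThetaO k)
    (h : Tendsto (fun n => emb (θn n)) atTop (𝓝 θ)) {i : Fin k} (hi : i ∈ I0 θ) :
    Tendsto (fun n => θn n i) atTop (𝓝 (realParam θ i)) := by
  simp only [I0, Finset.mem_filter, Finset.mem_univ, true_and] at hi
  exact (tendsto_mean h hi.2.1 hi.2.2).prodMk_nhds (tendsto_scale hmem h hi.1.2)

/-- Away from the limits of the means, a point keeps its distance from the means. -/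
theorem exists_le_abs_sub_mean (h : Tendsto (fun n => emb (θn n)) atTop (𝓝 θ)) {i : Fin k} {y : ℝ}
    (hy : y ≠ (θ i).1.toReal) :
    ∃ δ > 0, ∀ᶠ p : ℕ × ℝ in atTop ×ˢ 𝓝 y, δ ≤ |p.2 - (θn p.1 i).1| := by
  by_cases hi : (θ i).1 = ⊥ ∨ (θ i).1 = ⊤
  · exact ⟨1, one_pos, (tendsto_abs_sub_atTop ((tendsto_abs_mean h hi).comp tendsto_fst)
      tendsto_snd).eventually_ge_atTop 1⟩
  · push Not at hi
    have hpos : 0 < |y - (θ i).1.toReal| := abs_pos.2 (sub_ne_zero.2 hy)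
    have ht : Tendsto (fun p : ℕ × ℝ => |p.2 - (θn p.1 i).1|) (atTop ×ˢ 𝓝 y)
        (𝓝 |y - (θ i).1.toReal|) :=
      (tendsto_snd.sub ((tendsto_mean h hi.1 hi.2).comp tendsto_fst)).abs
    exact ⟨_, half_pos hpos, (ht.eventually_const_lt (half_lt_self hpos)).mono fun _ h => h.le⟩

theorem extSimplex_convex : Convex ℝ (extSimplex θ) := by
  refine (convex_stdSimplex ℝ (Fin k)).inter ?_
  intro v hv w hw a b _ _ _ i hi
  have h1 : v i = 0 := hv i hi
  have h2 : w i = 0 := hw i hi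
  simp [h1, h2]

theorem single_mem_extSimplex {j : Fin k} (hj : j ∈ I0 θ) : Pi.single j 1 ∈ extSimplex θ := by
  refine ⟨single_mem_stdSimplex ℝ j, fun i hi => ?_⟩
  have h0 := (Finset.mem_filter.1 hj).2.1.1
  have h1 := (Finset.mem_filter.1 hi).2
  exact Pi.single_eq_of_ne (fun h => h0 (by rw [← h]; exact h1)) _

theorem tObj_eq {f : ℝ → ℝ} (hf : MemLp f 2 volume) (K : Matrix (I1 θ) (I1 θ) ℝ) (w : Fin k → ℝ) :
    tObj f θ K w =
      ‖hf.toLp f - ∑ i ∈ I0 θ, w i • gaussL2 (realParam θ i)‖ ^ 2 + quadForm K w := by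
  rw [← l2norm_sub_sum_gauss]
  rfl

end Compactification

/-! ### Convergence of the criteria along a sequence of parameters -/

/-- Parameters `θn n` converging to a point `θ` of the compactification together with the Gram
matrices on `I1 θ`, and density estimators `φ n` that are uniformly bounded and converge to `f` in
`L²`. -/
structure Approach {k : ℕ} (f : ℝ → ℝ) (φ : ℕ → ℝ → ℝ) (θn : ℕ → Fin k → ℝ × ℝ)
    (θ : Fin k → EReal × ℝ≥0∞) (K : Matrix (I1 θ) (I1 θ) ℝ) : Prop where
  mem : ∀ n, θn n ∈ ThetaO k
  tendsto_emb : Tendsto (fun n => emb (θn n)) atTop (𝓝 θ)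
  nonempty : (I0 θ).Nonempty
  tendsto_gram : ∀ i j : I1 θ, Tendsto (fun n => gram (θn n) i j) atTop (𝓝 (K i j))
  memLp : ∀ n, MemLp (φ n) 2 volume
  tendsto_eLpNorm : Tendsto (fun n => eLpNorm (fun y => φ n y - f y) 2 volume) atTop (𝓝 0)
  bounded : ∃ B : ℝ, 0 ≤ B ∧ ∀ n, ∀ᵐ y, φ n y ≤ B

section Core

variable {k : ℕ} {wstar : Fin k → ℝ} {θstar : Fin k → ℝ × ℝ} {φ : ℕ → ℝ → ℝ}
  {θn : ℕ → Fin k → ℝ × ℝ} {θ : Fin k → EReal × ℝ≥0∞} {K : Matrix (I1 θ) (I1 θ) ℝ}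

theorem Approach.comp {f : ℝ → ℝ} (h : Approach f φ θn θ K) {s : ℕ → ℕ}
    (hs : Tendsto s atTop atTop) : Approach f (fun n => φ (s n)) (fun n => θn (s n)) θ K where
  mem n := h.mem _
  tendsto_emb := h.tendsto_emb.comp hs
  nonempty := h.nonempty
  tendsto_gram i j := (h.tendsto_gram i j).comp hs
  memLp n := h.memLp _
  tendsto_eLpNorm := h.tendsto_eLpNorm.comp hs
  bounded := by
    obtain ⟨B, h0, hB⟩ := h.bounded
    exact ⟨B, h0, fun n => hB _⟩

theorem Approach.tendsto_toLp (h : Approach (mix wstar θstar) φ θn θ K) :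
    Tendsto (fun n => (h.memLp n).toLp (φ n)) atTop (𝓝 ((memLp_mix wstar θstar).toLp _)) :=
  (Lp.tendsto_Lp_iff_tendsto_eLpNorm'' φ h.memLp _ (memLp_mix wstar θstar)).2 h.tendsto_eLpNorm

theorem Approach.tendsto_inner {f : ℝ → ℝ} (h : Approach f φ θn θ K) (i j : I1 θ) :
    Tendsto (fun n => (inner ℝ (gaussL2 (θn n i)) (gaussL2 (θn n j)) : ℝ)) atTop (𝓝 (K i j)) := by
  refine (h.tendsto_gram i j).congr fun n => ?_
  rw [inner_gaussL2 (h.mem n i) (h.mem n j), ← integral_gauss_mul_gauss (h.mem n i) (h.mem n j)]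
  rfl

/-- The fitted weights are of the order of the scales: the optimality condition against a component
that converges bounds `w_i ‖g_i‖²`, because `⟨φ, g_i⟩ ≤ sup φ`. So a degenerating component
contributes a bounded function. -/
theorem Approach.exists_weights_le (h : Approach (mix wstar θstar) φ θn θ K) {v : ℕ → Fin k → ℝ}
    (hv : ∀ n, IsWeights (φ n) (θn n) (v n)) :
    ∃ C : ℝ, 0 < C ∧ ∀ᶠ n in atTop, ∀ i, v n i ≤ C * (θn n i).2 := by
  obtain ⟨B, hB0, hB⟩ := h.bounded
  obtain ⟨j, hj⟩ := h.nonempty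
  have hg := tendsto_gaussL2 (tendsto_realParam h.mem h.tendsto_emb hj) (realParam_pos hj)
  have hlim := (h.tendsto_toLp.sub hg).norm.mul hg.norm
  obtain ⟨M, hM⟩ := hlim.isBoundedUnder_le
  refine ⟨(B + |M| + 1) * (2 * √Real.pi), by positivity, ?_⟩
  filter_upwards [eventually_map.1 hM] with n hn i
  have hp := h.mem n i
  have hint : (inner ℝ ((h.memLp n).toLp (φ n)) (gaussL2 (θn n i)) : ℝ) ≤ B := by
    rw [gaussL2, inner_toLp_eq]
    calc ∫ y, φ n y * gauss (θn n i) y ≤ ∫ y, B * gauss (θn n i) y := by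
          refine integral_mono_ae ((h.memLp n).integrable_mul (memLp_gauss _))
            ((integrable_gauss _).const_mul B) ?_
          filter_upwards [hB n] with y hy
          exact mul_le_mul_of_nonneg_right hy (gauss_nonneg _ _)
      _ = B := by rw [integral_const_mul, integral_gauss hp, mul_one]
  have key := weight_mul_norm_sq_le (a := fun i => gaussL2 (θn n i)) (hv n).1
    ((hv n).norm_le (h.memLp n))
    (fun i j => by rw [inner_gaussL2 (h.mem n i) (h.mem n j)]; exact (gaussInner_pos (h.mem n i)).le)
    hB0 hint j
  rw [norm_gaussL2_sq hp] at key
  have h1 : v n i * (2 * √Real.pi * (θn n i).2)⁻¹ ≤ B + |M| + 1 := by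
    have := le_abs_self M
    have hn' : ‖(h.memLp n).toLp (φ n) - gaussL2 (θn n j)‖ * ‖gaussL2 (θn n j)‖ ≤ M := hn
    linarith
  have h2 : 0 < 2 * √Real.pi * (θn n i).2 := by have : 0 < (θn n i).2 := hp; positivity
  rw [← div_eq_mul_inv, div_le_iff₀ h2] at h1
  linarith

/-- Limit of the objective for converging weights. -/
theorem Approach.tendsto_objective (h : Approach (mix wstar θstar) φ θn θ K)
    (hθ : θstar ∈ ThetaO k) {w : ℕ → Fin k → ℝ} {u : Fin k → ℝ} (hw : Tendsto w atTop (𝓝 u))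
    (hw0 : ∀ n i, 0 ≤ w n i) {C : ℝ}
    (hC : ∀ i ∈ I3 θ, ∀ᶠ n in atTop, w n i ≤ C * (θn n i).2) :
    Tendsto (fun n => ‖(h.memLp n).toLp (φ n) - ∑ i, w n i • gaussL2 (θn n i)‖ ^ 2) atTop
      (𝓝 (tObj (mix wstar θstar) θ K u)) := by
  rw [tObj_eq (memLp_mix wstar θstar)]
  have hI1 : ∀ i ∈ I1 θ, Tendsto (fun n => |(θn n i).1|) atTop atTop ∧
      Tendsto (fun n => (θn n i).2) atTop (𝓝 (θ i).2.toReal) ∧ 0 < (θ i).2.toReal := by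
    intro i hi
    simp only [I1, Finset.mem_filter, Finset.mem_univ, true_and] at hi
    exact ⟨tendsto_abs_mean h.tendsto_emb hi.2, tendsto_scale h.mem h.tendsto_emb hi.1.2,
      scale_pos hi.1.1 hi.1.2⟩
  refine tendsto_norm_sub_sum_sq disjoint_I0_I1 h.tendsto_toLp
    (fun i hi => tendsto_gaussL2 (tendsto_realParam h.mem h.tendsto_emb hi) (realParam_pos hi))
    (fun i hi => ?_) (fun i hi j hj => ?_) h.tendsto_inner hw (fun i h0 h1 => ?_)
  · obtain ⟨a, b, c⟩ := hI1 i hi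
    have : Tendsto (fun n => ∑ j, wstar j * gaussInner (θstar j) (θn n i)) atTop
        (𝓝 (∑ j, wstar j * 0)) :=
      tendsto_finsetSum _ fun j _ => (tendsto_gaussInner_of_mean a b c _).const_mul _
    simp only [mul_zero, Finset.sum_const_zero] at this
    exact this.congr fun n => (inner_mix_gaussL2 (h.mem n i) hθ).symm
  · obtain ⟨a, b, c⟩ := hI1 i hi
    exact (tendsto_gaussInner_of_mean a b c _).congr fun n =>
      (inner_gaussL2 (realParam_pos hj) (h.mem n i)).symm
  · by_cases h3 : (θ i).2 = 0
    · refine tendsto_smul_gaussL2_of_scale_zero (fun n => h.mem n i) ?_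
        (Eventually.of_forall fun n => hw0 n i) (hC i (by simp [I3, h3]))
      have := tendsto_scale h.mem h.tendsto_emb (i := i) (by simp [h3])
      simpa [h3] using this
    · have htop : (θ i).2 = ⊤ := by
        simp only [I0, I1, Finset.mem_filter, Finset.mem_univ, true_and] at h0 h1
        tauto
      simpa using ((tendsto_pi_nhds.1 hw) i).smul
        (tendsto_gaussL2_of_scale_atTop (tendsto_scale_atTop h.tendsto_emb htop))

/-- Limits of fitted weights minimize the limit objective. -/
theorem Approach.isExtWeights (h : Approach (mix wstar θstar) φ θn θ K) (hθ : θstar ∈ ThetaO k)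
    {v : ℕ → Fin k → ℝ} (hv : ∀ n, IsWeights (φ n) (θn n) (v n)) {u : Fin k → ℝ}
    (hu : Tendsto v atTop (𝓝 u)) : IsExtWeights (mix wstar θstar) θ K u := by
  obtain ⟨C, hC, hvC⟩ := h.exists_weights_le hv
  have hus : u ∈ stdSimplex ℝ (Fin k) :=
    (isClosed_stdSimplex ℝ (Fin k)).mem_of_tendsto hu (Eventually.of_forall fun n => (hv n).1)
  refine ⟨⟨hus, fun i hi => le_antisymm ?_ (hus.1 i)⟩, fun w hw => ?_⟩
  · have h3 : (θ i).2 = 0 := (Finset.mem_filter.1 hi).2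
    have hs := tendsto_scale h.mem h.tendsto_emb (i := i) (by simp [h3])
    have := le_of_tendsto_of_tendsto ((tendsto_pi_nhds.1 hu) i) (hs.const_mul C)
      (hvC.mono fun n hn => hn i)
    simpa [h3] using this
  · have h1 := h.tendsto_objective hθ hu (fun n i => (hv n).1.1 i)
      (fun i _ => hvC.mono fun n hn => hn i)
    have h2 := h.tendsto_objective (C := 0) hθ (tendsto_const_nhds (x := w))
      (fun _ i => hw.1.1 i) (fun i hi => Eventually.of_forall fun n => by simp [hw.2 i hi])
    exact le_of_tendsto_of_tendsto' h1 h2 fun n =>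
      pow_le_pow_left₀ (norm_nonneg _) ((hv n).norm_le (h.memLp n) w hw.1) 2

/-- A limit of fitted weights charges a component that converges. -/
theorem Approach.exists_pos (h : Approach (mix wstar θstar) φ θn θ K) (hθ : θstar ∈ ThetaO k)
    (hk : 0 < k) (hw : ∀ i, 0 < wstar i) {u : Fin k → ℝ}
    (hu : IsExtWeights (mix wstar θstar) θ K u) : ∃ i ∈ I0 θ, 0 < u i := by
  obtain ⟨j, hj⟩ := h.nonempty
  have hmin := hu.2
  rw [funext (tObj_eq (memLp_mix wstar θstar) K)] at hmin
  obtain ⟨i, hi, hne⟩ := exists_ne_zero_of_isMinOn disjoint_I0_I1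
    (quadForm_nonneg_of_tendsto (a := fun n i => gaussL2 (θn n i)) h.tendsto_inner)
    extSimplex_convex hu.1 hmin hj
    (single_mem_extSimplex hj) (by
      rw [inner_mix_gaussL2 (realParam_pos hj) hθ]
      exact Finset.sum_pos (fun i _ => mul_pos (hw i) (gaussInner_pos (hθ i))) ⟨⟨0, hk⟩, by simp⟩)
  exact ⟨i, hi, lt_of_le_of_ne (hu.1.1.1 i) hne.symm⟩

/-- The limit mixture does not depend on the minimizer. -/
theorem Approach.mix0_ae_eq (h : Approach (mix wstar θstar) φ θn θ K) {u u' : Fin k → ℝ}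
    (hu : IsExtWeights (mix wstar θstar) θ K u) (hu' : IsExtWeights (mix wstar θstar) θ K u') :
    mix0 u θ =ᵐ[volume] mix0 u' θ := by
  have h1 := hu.2
  have h2 := hu'.2
  rw [funext (tObj_eq (memLp_mix wstar θstar) K)] at h1 h2
  have := sum_smul_eq_of_isMinOn
    (quadForm_nonneg_of_tendsto (a := fun n i => gaussL2 (θn n i)) h.tendsto_inner)
    extSimplex_convex hu.1 hu'.1 h1 h2
  have e := coeFn_sum_gaussL2 (I0 θ) u (realParam θ)
  rw [this] at e
  exact e.symm.trans (coeFn_sum_gaussL2 (I0 θ) u' (realParam θ))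

/-- Away from the limits of the means, the fitted mixtures converge continuously to the mixture of
the components that converge. -/
theorem Approach.tendsto_mix {f : ℝ → ℝ} (h : Approach f φ θn θ K) {v : ℕ → Fin k → ℝ}
    {u : Fin k → ℝ} (hu : Tendsto v atTop (𝓝 u)) (hv0 : ∀ n i, 0 ≤ v n i) {C : ℝ}
    (hC : ∀ᶠ n in atTop, ∀ i, v n i ≤ C * (θn n i).2) {y : ℝ} (hy : ∀ i, y ≠ (θ i).1.toReal) :
    Tendsto (fun p : ℕ × ℝ => mix (v p.1) (θn p.1) p.2) (atTop ×ˢ 𝓝 y) (𝓝 (mix0 u θ y)) := by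
  have e : mix0 u θ y = ∑ i, if i ∈ I0 θ then u i * gauss (realParam θ i) y else 0 := by
    rw [Finset.sum_ite_mem, Finset.univ_inter]
    rfl
  rw [e]
  refine tendsto_finsetSum _ fun i _ => ?_
  have hui : Tendsto (fun p : ℕ × ℝ => v p.1 i) (atTop ×ˢ 𝓝 y) (𝓝 (u i)) :=
    ((tendsto_pi_nhds.1 hu) i).comp tendsto_fst
  split_ifs with h0
  · exact hui.mul (tendsto_gauss ((tendsto_realParam h.mem h.tendsto_emb h0).comp tendsto_fst)
      (realParam_pos h0) tendsto_snd)
  by_cases h3 : (θ i).2 = 0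
  · obtain ⟨δ, hδ, hev⟩ := exists_le_abs_sub_mean h.tendsto_emb (hy i)
    refine tendsto_mul_gauss_of_scale_zero (p := fun p : ℕ × ℝ => θn p.1 i) hδ (C := C)
      (fun p => h.mem p.1 i) ?_
      (Eventually.of_forall fun p => hv0 p.1 i)
      (tendsto_fst.eventually (hC.mono fun n hn => hn i)) hev
    have := tendsto_scale h.mem h.tendsto_emb (i := i) (by simp [h3])
    rw [h3] at this
    exact this.comp tendsto_fst
  by_cases htop : (θ i).2 = ⊤
  · simpa using hui.mul (tendsto_gauss_of_scale_atTop (p := fun p : ℕ × ℝ => θn p.1 i)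
      ((tendsto_scale_atTop h.tendsto_emb htop).comp tendsto_fst) Prod.snd)
  · have hm : (θ i).1 = ⊥ ∨ (θ i).1 = ⊤ := by
      simp only [I0, Finset.mem_filter, Finset.mem_univ, true_and] at h0
      tauto
    simpa using hui.mul (tendsto_gauss_of_mean (p := fun p : ℕ × ℝ => θn p.1 i)
      ((tendsto_abs_mean h.tendsto_emb hm).comp tendsto_fst)
      ((tendsto_scale h.mem h.tendsto_emb htop).comp tendsto_fst) (scale_pos h3 htop) tendsto_snd)

/-- Convergence of the integrated logarithms along a sequence with converging weights. -/
theorem Approach.tendsto_integral_of_weights (h : Approach (mix wstar θstar) φ θn θ K)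
    (hθ : θstar ∈ ThetaO k) (hk : 0 < k) (hw : ∀ i, 0 < wstar i) {μs : ℕ → Measure ℝ}
    (hμ : QuadConv μs (law (mix wstar θstar))) {v : ℕ → Fin k → ℝ}
    (hv : ∀ n, IsWeights (φ n) (θn n) (v n)) {u : Fin k → ℝ} (hu : Tendsto v atTop (𝓝 u)) :
    ∃ L : ℝ, ellExt (mix wstar θstar) θ K = (L : EReal) ∧
      Tendsto (fun n => ∫ y, Real.log (mix (v n) (θn n) y) ∂(μs n)) atTop (𝓝 L) := by
  have hext := h.isExtWeights hθ hv hu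
  obtain ⟨i, hi, hui⟩ := h.exists_pos hθ hk hw hext
  obtain ⟨C, hC, hvC⟩ := h.exists_weights_le hv
  have hpos : ∀ y, 0 < mix0 u θ y := fun y =>
    Finset.sum_pos' (fun j _ => mul_nonneg (hext.1.1.1 j) (gauss_nonneg _ _))
      ⟨i, hi, mul_pos hui (gauss_pos (realParam_pos hi) y)⟩
  have hcont : Continuous fun y => Real.log (mix0 u θ y) :=
    (continuous_sum_gauss (I0 θ) u (realParam θ)).log fun y => (hpos y).ne'
  have hs := realParam_pos hi
  have hpi := tendsto_realParam h.mem h.tendsto_emb hi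
  -- uniform quadratic bounds for the logarithms
  have hb1 : ∃ D, ∀ᶠ n in atTop, ∀ y, |Real.log (mix (v n) (θn n) y)| ≤ D * (1 + y ^ 2) := by
    refine ⟨|Real.log (k * C)| +
      |Real.log (u i / 2 * (√(2 * Real.pi) * ((realParam θ i).2 + 1))⁻¹)| +
        (1 + (|(realParam θ i).1| + 1) ^ 2) / ((realParam θ i).2 / 2) ^ 2, ?_⟩
    filter_upwards [hvC, ((tendsto_pi_nhds.1 hu) i).eventually_const_le (half_lt_self hui),
      hpi.snd_nhds.eventually_const_le (half_lt_self hs),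
      hpi.snd_nhds.eventually_le_const (lt_add_one _),
      hpi.fst_nhds.abs.eventually_le_const (lt_add_one _)] with n e1 e2 e3 e4 e5 y
    refine abs_log_sum_gauss_le (A := k * C) (fun j _ => (hv n).1.1 j) ?_ (Finset.mem_univ i)
      (half_pos hui) e2 (half_pos hs) e3 e4 e5
    have hterm : ∀ j ∈ Finset.univ, v n j * gauss (θn n j) y ≤ C := by
      intro j _
      have hj : 0 < (θn n j).2 := h.mem n j
      have hsq : 1 ≤ √(2 * Real.pi) :=
        Real.one_le_sqrt.2 (by linarith [Real.pi_gt_three])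
      calc v n j * gauss (θn n j) y
          ≤ C * (θn n j).2 * (√(2 * Real.pi) * (θn n j).2)⁻¹ :=
            mul_le_mul (e1 j) (gauss_le hj y) (gauss_nonneg _ _) (by positivity)
        _ = C / √(2 * Real.pi) := by field_simp
        _ ≤ C := div_le_self hC.le hsq
    simpa using Finset.sum_le_sum hterm
  have hb2 : ∃ D, ∀ y, |Real.log (mix0 u θ y)| ≤ D * (1 + y ^ 2) := by
    refine ⟨_, fun y => abs_log_sum_gauss_le (S := I0 θ) (w := u) (q := realParam θ)
      (A := ∑ j ∈ I0 θ, u j * (√(2 * Real.pi) * (realParam θ j).2)⁻¹)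
      (fun j _ => hext.1.1.1 j) (Finset.sum_le_sum fun j hj => ?_) hi hui le_rfl hs le_rfl le_rfl
      le_rfl⟩
    exact mul_le_mul_of_nonneg_left (gauss_le (realParam_pos hj) y) (hext.1.1.1 j)
  obtain ⟨D1, hD1⟩ := hb1
  obtain ⟨D2, hD2⟩ := hb2
  have hint : Integrable (fun y => Real.log (mix0 u θ y)) (law (mix wstar θstar)) :=
    integrable_of_abs_le_quad hμ.integrable_lim hcont.aestronglyMeasurable hD2
  refine ⟨∫ y, Real.log (mix0 u θ y) ∂(law (mix wstar θstar)), ?_, ?_⟩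
  · rw [← expLog_eq_integral hpos hint, ellExt]
    exact expLog_congr ((law_absolutelyContinuous _).ae_le
      (h.mix0_ae_eq (isExtWeights_extWeights (memLp_mix _ _) h.nonempty K) hext))
  · refine hμ.tendsto_integral (C := max D1 D2) (fun i => (θ i).1.toReal)
      (fun i => law_absolutelyContinuous _ (by simp))
      (fun n => (continuous_mix _ _).measurable.log) hcont ?_ (fun y => (hD2 y).trans ?_)
      fun y hy => ?_
    · filter_upwards [hD1] with n hn y
      refine (hn y).trans ?_
      gcongr
      exact le_max_left _ _
    · gcongr
      exact le_max_right _ _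
    · exact (h.tendsto_mix hu (fun n => (hv n).1.1) hvC hy).log (hpos y).ne'

/-- Convergence of the integrated logarithms of the fitted mixtures; the weights converge along
subsequences. -/
theorem Approach.tendsto_integral (h : Approach (mix wstar θstar) φ θn θ K)
    (hθ : θstar ∈ ThetaO k) (hk : 0 < k) (hw : ∀ i, 0 < wstar i) {μs : ℕ → Measure ℝ}
    (hμ : QuadConv μs (law (mix wstar θstar))) :
    ∃ L : ℝ, ellExt (mix wstar θstar) θ K = (L : EReal) ∧
      Tendsto (fun n => ∫ y, Real.log (fit (φ n) (θn n) y) ∂(μs n)) atTop (𝓝 L) := by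
  have hv : ∀ n, IsWeights (φ n) (θn n) (weights (φ n) (θn n)) := fun n =>
    isWeights_weights hk (h.memLp n) _
  have key : ∀ s : ℕ → ℕ, Tendsto s atTop atTop → ∃ r : ℕ → ℕ, ∃ L : ℝ,
      ellExt (mix wstar θstar) θ K = (L : EReal) ∧
      Tendsto (fun n => ∫ y, Real.log (fit (φ (s (r n))) (θn (s (r n))) y) ∂(μs (s (r n)))) atTop
        (𝓝 L) := by
    intro s hs
    obtain ⟨u, -, r, hr, hu⟩ := (isCompact_stdSimplex ℝ (Fin k)).tendsto_subseq
      fun n => (hv (s n)).1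
    have hsr := hs.comp hr.tendsto_atTop
    obtain ⟨L, hL⟩ := (h.comp hsr).tendsto_integral_of_weights hθ hk hw (hμ.comp hsr)
      (fun n => hv _) hu
    exact ⟨r, L, hL⟩
  obtain ⟨_, L, hL, -⟩ := key id tendsto_id
  refine ⟨L, hL, tendsto_of_subseq_tendsto fun s hs => ?_⟩
  obtain ⟨r, L', hL', ht⟩ := key s hs
  have : L' = L := EReal.coe_injective (hL'.symm.trans hL)
  exact ⟨r, this ▸ ht⟩

end Core

/-! ### Uniform convergence by compactness -/

/-- A parameter sequence in a box has a subsequence that converges in the compactification, with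
a component in `I0` at the limit, along which the Gram matrices on `I1` converge. -/
theorem exists_subseq_of_mem_box {k : ℕ} {u U N : ℝ} (hu : 0 < u) {θn : ℕ → Fin k → ℝ × ℝ}
    (hθn : ∀ n, θn n ∈ ThetaBox k u U N) :
    ∃ (θ : Fin k → EReal × ℝ≥0∞) (K : Matrix (I1 θ) (I1 θ) ℝ) (s : ℕ → ℕ), StrictMono s ∧
      Tendsto (fun n => emb (θn (s n))) atTop (𝓝 θ) ∧ (I0 θ).Nonempty ∧
      ∀ i j : I1 θ, Tendsto (fun n => gram (θn (s n)) i j) atTop (𝓝 (K i j)) := by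
  have hmem : ∀ n, θn n ∈ ThetaO k := fun n => (hθn n).1
  obtain ⟨θ, s, hs, hθ⟩ := CompactSpace.tendsto_subseq fun n => emb (θn n)
  have hθ' : Tendsto (fun n => emb (θn (s n))) atTop (𝓝 θ) := hθ
  -- the box condition is closed in the compactification
  have hne : (I0 θ).Nonempty := by
    let Z : Set (EReal × ℝ≥0∞) :=
      Set.Icc ((-N : ℝ) : EReal) (N : EReal) ×ˢ Set.Icc (ENNReal.ofReal u) (ENNReal.ofReal U)
    have hZ : IsClosed Z := isClosed_Icc.prod isClosed_Icc
    have hcl : IsClosed (⋃ i, {x : Fin k → EReal × ℝ≥0∞ | x i ∈ Z}) :=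
      isClosed_iUnion_of_finite fun i => hZ.preimage (continuous_apply i)
    have hin : θ ∈ ⋃ i, {x : Fin k → EReal × ℝ≥0∞ | x i ∈ Z} := by
      refine hcl.mem_of_tendsto hθ' (Eventually.of_forall fun n => ?_)
      obtain ⟨-, i, h1, h2⟩ := hθn (s n)
      exact Set.mem_iUnion.2 ⟨i, ⟨EReal.coe_le_coe_iff.2 h1.1, EReal.coe_le_coe_iff.2 h1.2⟩,
        ENNReal.ofReal_le_ofReal h2.1, ENNReal.ofReal_le_ofReal h2.2⟩
    obtain ⟨i, ⟨h1, h2⟩, h3, h4⟩ := Set.mem_iUnion.1 hin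
    refine ⟨i, Finset.mem_filter.2 ⟨Finset.mem_univ i, ⟨?_, ?_⟩, ?_, ?_⟩⟩
    · exact ((ENNReal.ofReal_pos.2 hu).trans_le h3).ne'
    · exact (h4.trans_lt ENNReal.ofReal_lt_top).ne
    · exact ((EReal.bot_lt_coe _).trans_le h1).ne'
    · exact (h2.trans_lt (EReal.coe_lt_top _)).ne
  -- the scales on `I1` stay away from zero, so the Gram entries are bounded
  let M : I1 θ → ℝ := fun j => (√(2 * Real.pi) * ((θ j).2.toReal / 2))⁻¹
  have hcomp : IsCompact (Set.pi Set.univ fun _ : I1 θ => Set.pi Set.univ fun j : I1 θ =>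
      Set.Icc 0 (M j)) :=
    isCompact_univ_pi fun _ => isCompact_univ_pi fun _ => isCompact_Icc
  have hev : ∀ᶠ n in atTop, (fun i j : I1 θ => gram (θn (s n)) i j) ∈
      Set.pi Set.univ fun _ : I1 θ => Set.pi Set.univ fun j : I1 θ => Set.Icc 0 (M j) := by
    have : ∀ j : I1 θ, ∀ᶠ n in atTop, (θ j).2.toReal / 2 ≤ (θn (s n) j).2 := by
      intro j
      have hj := (Finset.mem_filter.1 j.2).2.1
      exact (tendsto_scale (fun n => hmem (s n)) hθ' hj.2).eventually_const_le
        (half_lt_self (scale_pos hj.1 hj.2))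
    filter_upwards [eventually_all.2 this] with n hn i _ j _
    have hj := (Finset.mem_filter.1 j.2).2.1
    have h0 := scale_pos hj.1 hj.2
    have e : gram (θn (s n)) i j = gaussInner (θn (s n) i) (θn (s n) j) :=
      integral_gauss_mul_gauss (hmem _ i) (hmem _ j)
    simp only [e]
    refine ⟨(gaussInner_pos (hmem _ i)).le, (gaussInner_le (hmem _ j)).trans ?_⟩
    have := hn j
    simp only [M]
    gcongr
  obtain ⟨K, -, r, hr, hK⟩ := hcomp.tendsto_subseq' hev.frequently
  exact ⟨θ, K, s ∘ r, hs.comp hr, hθ'.comp hr.tendsto_atTop, hne, fun i j =>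
    (tendsto_pi_nhds.1 ((tendsto_pi_nhds.1 hK) i)) j⟩

/-- A supremum of nonnegative functions tends to zero if every sequence of arguments, along indices
tending to infinity, has a subsequence along which the values tend to zero. -/
theorem tendsto_iSup_zero_of_subseq {β : Type*} {A : Set β} {F : ℕ → β → ℝ}
    (h : ∀ (s : ℕ → ℕ) (x : ℕ → β), Tendsto s atTop atTop → (∀ n, x n ∈ A) →
      ∃ r : ℕ → ℕ, Tendsto (fun n => F (s (r n)) (x (r n))) atTop (𝓝 0)) :
    Tendsto (fun n => ⨆ x ∈ A, ENNReal.ofReal |F n x|) atTop (𝓝 0) := by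
  rw [ENNReal.tendsto_atTop_zero]
  by_contra! hcon
  obtain ⟨ε, hε, hcon⟩ := hcon
  have hex : ∀ m, ∃ n ≥ m, ∃ x ∈ A, ε < ENNReal.ofReal |F n x| := by
    intro m
    obtain ⟨n, hn, hlt⟩ := hcon m
    obtain ⟨x, hx⟩ := lt_iSup_iff.1 hlt
    obtain ⟨hxA, hx⟩ := lt_iSup_iff.1 hx
    exact ⟨n, hn, x, hxA, hx⟩
  choose s hs x hxA hx using hex
  obtain ⟨r, hr⟩ := h s x (tendsto_atTop_mono hs tendsto_id) hxA
  have h0 : Tendsto (fun n => ENNReal.ofReal |F (s (r n)) (x (r n))|) atTop (𝓝 0) := by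
    simpa using ENNReal.tendsto_ofReal hr.abs
  obtain ⟨n, hn⟩ := (h0.eventually_lt_const hε).exists
  exact absurd hn (hx (r n)).not_gt

theorem mix_le {k : ℕ} {w : Fin k → ℝ} {θ : Fin k → ℝ × ℝ} (hw : ∀ i, 0 ≤ w i) (hθ : θ ∈ ThetaO k)
    (y : ℝ) : mix w θ y ≤ ∑ i, w i * (√(2 * Real.pi) * (θ i).2)⁻¹ :=
  Finset.sum_le_sum fun i _ => mul_le_mul_of_nonneg_left (gauss_le (hθ i) y) (hw i)

theorem ae_le_toReal_eLpNorm_top {φ : ℝ → ℝ} {B : ℝ≥0∞} (hB : B ≠ ∞)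
    (h : eLpNorm φ ∞ volume ≤ B) : ∀ᵐ y, φ y ≤ B.toReal := by
  rw [eLpNorm_exponent_top] at h
  filter_upwards [ae_le_eLpNormEssSup (f := φ) (μ := volume)] with y hy
  have h1 : ‖φ y‖ₑ.toReal ≤ B.toReal := ENNReal.toReal_mono hB (hy.trans h)
  rw [toReal_enorm] at h1
  exact (le_abs_self _).trans h1

end GaussMix

open GaussMix

theorem proposition6p1 {Ω : Type*} [MeasurableSpace Ω] (P : Measure Ω) [IsProbabilityMeasure P]
    (k : ℕ)
    -- the true mixture: distinct components and strictly positive weights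
    (θstar : Fin k → ℝ × ℝ) (hθstar : θstar ∈ GaussMix.ThetaO k)
    (hdistinct : Function.Injective θstar)
    (wstar : Fin k → ℝ) (hwstar : ∀ i, 0 < wstar i) (hwsum : ∑ i, wstar i = 1)
    (f : ℝ → ℝ) (hf : f = GaussMix.mix wstar θstar)
    -- the i.i.d. sample with density `f`
    (Y : ℕ → Ω → ℝ) (hYlaw : ∀ t, HasLaw (Y t) (GaussMix.law f) P) (hYindep : iIndepFun Y P)
    -- the density estimators
    (fhat : ℕ → Ω → ℝ → ℝ)
    (hfhat_L2 : ∀ n ω, 1 ≤ n → MemLp (fhat n ω) 2 volume)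
    (hfhat_nonneg : ∀ n ω, 1 ≤ n → ∀ y, 0 ≤ fhat n ω y)
    (hfhat_int : ∀ n ω, 1 ≤ n → ∫⁻ y, ENNReal.ofReal (fhat n ω y) = 1)
    (hfhat_conv : ∀ᵐ ω ∂P,
      Tendsto (fun n => eLpNorm (fun y => fhat n ω y - f y) 2 volume) atTop (𝓝 0))
    (hfhat_bdd : ∀ᵐ ω ∂P, (⨆ n ≥ 1, eLpNorm (fhat n ω) ∞ volume) < ∞) :
    -- the expectation defining `ℓ(θ)` exists
    (∀ θ ∈ GaussMix.ThetaO k,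
      Integrable (fun y => Real.log (GaussMix.fit f θ y)) (GaussMix.law f)) ∧
    -- `ℓ_n(θⁿ) → ℓ(θ,K)`, on an almost sure set that serves all sequences and limits
    (∀ᵐ ω ∂P, ∀ (θn : ℕ → Fin k → ℝ × ℝ) (θ : Fin k → EReal × ℝ≥0∞)
      (K : Matrix (GaussMix.I1 θ) (GaussMix.I1 θ) ℝ),
      (∀ n, θn n ∈ GaussMix.ThetaO k) →
      Tendsto (fun n => GaussMix.emb (θn n)) atTop (𝓝 θ) →
      (GaussMix.I0 θ).Nonempty →
      (∀ i j : GaussMix.I1 θ, Tendsto (fun n => GaussMix.gram (θn n) i j) atTop (𝓝 (K i j))) →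
      Tendsto (fun n => (GaussMix.logPL n (fun t => Y t ω) (fhat n ω) (θn n) : EReal)) atTop
        (𝓝 (GaussMix.ellExt f θ K))) ∧
    -- `ℓ(θⁿ) → ℓ(θ,K)`
    (∀ (θn : ℕ → Fin k → ℝ × ℝ) (θ : Fin k → EReal × ℝ≥0∞)
      (K : Matrix (GaussMix.I1 θ) (GaussMix.I1 θ) ℝ),
      (∀ n, θn n ∈ GaussMix.ThetaO k) →
      Tendsto (fun n => GaussMix.emb (θn n)) atTop (𝓝 θ) →
      (GaussMix.I0 θ).Nonempty →
      (∀ i j : GaussMix.I1 θ, Tendsto (fun n => GaussMix.gram (θn n) i j) atTop (𝓝 (K i j))) →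
      Tendsto (fun n => (GaussMix.ell f (θn n) : EReal)) atTop (𝓝 (GaussMix.ellExt f θ K))) ∧
    -- uniform convergence
    (∀ u U N : ℝ, 0 < u → u < U → 0 < N → ∀ᵐ ω ∂P,
      Tendsto (fun n => ⨆ θ ∈ GaussMix.ThetaBox k u U N,
        ENNReal.ofReal |GaussMix.logPL n (fun t => Y t ω) (fhat n ω) θ - GaussMix.ell f θ|)
        atTop (𝓝 0)) := by
  have hw0 : ∀ i, 0 ≤ wstar i := fun i => (hwstar i).le
  have hk : 0 < k := by
    rcases k.eq_zero_or_pos with rfl | h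
    · simp at hwsum
    · exact h
  subst hf
  set f := mix wstar θstar with hf
  have hquad : Integrable (fun y : ℝ => 1 + y ^ 2) (law f) := integrable_quad_law hθstar hw0
  have hfin : IsFiniteMeasure (law f) := by
    rw [← (hYlaw 0).map_eq]
    infer_instance
  set B₀ : ℝ := ∑ i, wstar i * (√(2 * Real.pi) * (θstar i).2)⁻¹ with hB₀
  have hB₀0 : 0 ≤ B₀ := Finset.sum_nonneg fun i _ => by
    have h1 : 0 < (θstar i).2 := hθstar i
    have h2 := hw0 i
    positivity
  -- fitting the true density itself is the case of constant estimators
  have hell : ∀ (θn : ℕ → Fin k → ℝ × ℝ) (θ : Fin k → EReal × ℝ≥0∞) (K : Matrix (I1 θ) (I1 θ) ℝ),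
      (∀ n, θn n ∈ ThetaO k) → Tendsto (fun n => emb (θn n)) atTop (𝓝 θ) → (I0 θ).Nonempty →
      (∀ i j : I1 θ, Tendsto (fun n => gram (θn n) i j) atTop (𝓝 (K i j))) →
      ∃ L : ℝ, ellExt f θ K = (L : EReal) ∧ Tendsto (fun n => ell f (θn n)) atTop (𝓝 L) := by
    intro θn θ K h1 h2 h3 h4
    have happ : Approach f (fun _ => f) θn θ K :=
      ⟨h1, h2, h3, h4, fun _ => memLp_mix _ _, by simp,
        B₀, hB₀0, fun _ => Eventually.of_forall fun y => mix_le hw0 hθstar y⟩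
    exact happ.tendsto_integral hθstar hk hwstar (QuadConv.const hquad)
  have hlog : ∀ᵐ ω ∂P, ∀ (s : ℕ → ℕ), Tendsto s atTop atTop →
      ∀ (θn : ℕ → Fin k → ℝ × ℝ) (θ : Fin k → EReal × ℝ≥0∞) (K : Matrix (I1 θ) (I1 θ) ℝ),
      (∀ n, θn n ∈ ThetaO k) → Tendsto (fun n => emb (θn n)) atTop (𝓝 θ) → (I0 θ).Nonempty →
      (∀ i j : I1 θ, Tendsto (fun n => gram (θn n) i j) atTop (𝓝 (K i j))) →
      ∃ L : ℝ, ellExt f θ K = (L : EReal) ∧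
        Tendsto (fun n => logPL (s n) (fun t => Y t ω) (fhat (s n) ω) (θn n)) atTop (𝓝 L) := by
    filter_upwards [ae_quadConv_empirical hYlaw hYindep hquad, hfhat_conv, hfhat_bdd]
      with ω hq hconv hbdd s hs θn θ K h1 h2 h3 h4
    -- nothing is assumed about the estimator with index `0`, so `f` takes its place
    let φ : ℕ → ℝ → ℝ := fun n => if s n = 0 then f else fhat (s n) ω
    have hφ : ∀ᶠ n in atTop, φ n = fhat (s n) ω := by
      filter_upwards [hs.eventually_ge_atTop 1] with n hn
      exact if_neg (by omega)
    have happ : Approach f φ θn θ K := by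
      refine ⟨h1, h2, h3, h4, fun n => ?_, ?_,
        max B₀ (⨆ n ≥ 1, eLpNorm (fhat n ω) ∞ volume).toReal, hB₀0.trans (le_max_left _ _),
        fun n => ?_⟩
      · by_cases hn : s n = 0
        · simpa only [φ, if_pos hn] using memLp_mix _ _
        · simpa only [φ, if_neg hn] using hfhat_L2 _ ω (Nat.one_le_iff_ne_zero.2 hn)
      · refine (hconv.comp hs).congr' ?_
        filter_upwards [hφ] with n hn
        rw [hn]
        rfl
      · by_cases hn : s n = 0
        · simp only [φ, if_pos hn]
          exact Eventually.of_forall fun y => (mix_le hw0 hθstar y).trans (le_max_left _ _)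
        · simp only [φ, if_neg hn]
          have hle : eLpNorm (fhat (s n) ω) ∞ volume ≤ ⨆ n ≥ 1, eLpNorm (fhat n ω) ∞ volume :=
            le_iSup₂_of_le (s n) (Nat.one_le_iff_ne_zero.2 hn) le_rfl
          filter_upwards [ae_le_toReal_eLpNorm_top hbdd.ne hle] with y hy
          exact hy.trans (le_max_right _ _)
    obtain ⟨L, hL, ht⟩ := happ.tendsto_integral hθstar hk hwstar (hq.comp hs)
    refine ⟨L, hL, ht.congr' ?_⟩
    filter_upwards [hφ] with n hn
    rw [hn, integral_empirical]
    rfl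
  refine ⟨fun θ hθ => integrable_log_fit hθstar hw0 hk hθ, ?_, ?_, ?_⟩
  · filter_upwards [hlog] with ω hω θn θ K h1 h2 h3 h4
    obtain ⟨L, hL, ht⟩ := hω id tendsto_id θn θ K h1 h2 h3 h4
    rw [hL]
    exact (continuous_coe_real_ereal.tendsto L).comp ht
  · intro θn θ K h1 h2 h3 h4
    obtain ⟨L, hL, ht⟩ := hell θn θ K h1 h2 h3 h4
    rw [hL]
    exact (continuous_coe_real_ereal.tendsto L).comp ht
  · intro u U N hu _ _
    filter_upwards [hlog] with ω hω
    refine tendsto_iSup_zero_of_subseq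
      (F := fun n θ => logPL n (fun t => Y t ω) (fhat n ω) θ - ell f θ) fun s x hs hx => ?_
    obtain ⟨θ, K, r, hr, h2, h3, h4⟩ := exists_subseq_of_mem_box hu hx
    have hmem : ∀ n, x (r n) ∈ ThetaO k := fun n => (hx _).1
    obtain ⟨L, hL, ht⟩ := hω (s ∘ r) (hs.comp hr.tendsto_atTop) _ θ K hmem h2 h3 h4
    obtain ⟨L', hL', ht'⟩ := hell _ θ K hmem h2 h3 h4
    have hLL : L' = L := EReal.coe_injective (hL'.symm.trans hL)
    refine ⟨r, ?_⟩
    have := ht.sub ht'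
    rwa [hLL, sub_self] at this
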